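/- Let $m\ge 1$, $n\ge 1$, $C\ge 2$, let $(x_j,y_j)_{j=1}^n$ be training data with $x_j\in X$ (any set of inputs) and labels $y_j\in\{1,\dots,C\}$, and let $f(x;\theta)=(f_1(x;\theta),\dots,f_C(x;\theta))\in\mathbb{R}^C$ be a model with parameters $\theta\in\mathbb{R}^m$. Let $$\mathcal{L}(\theta)=-\frac1n\sum_{j=1}^n\log\frac{\exp(f_{y_j}(x_j;\theta))}{\sum_{c=1}^C\exp(f_c(x_j;\theta))},\qquad s_{jc}(\theta)=f_{y_j}(x_j;\theta)-f_c(x_j;\theta).$$ For a locally Lipschitz $F:\mathbb{R}^m\to\mathbb{R}$ let $\partial^\circ F(\theta)$ be Clarke's subdifferential, the convex hull of all limits $\lim_k\nabla F(\theta_k)$ with $\theta_k\to\theta$ and $F$ differentiable at each $\theta_k$. An arc is a map $z:[0,\infty)\to\mathbb{R}^m$ that is absolutely continuous on compact intervals. $F$ admits a chain rule if for every arc $z$ and almost every $t>0$, $(F\circ z)'(t)=\langle h,z'(t)\rangle$ for all $h\in\partial^\circ F(z(t))$. Let $\Lambda=\operatorname{diag}(\lambda_1,\dots,\lambda_m)$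 with $\lambda_i\ge 0$ and $\Lambda\ne 0$. Put $\lambda_{\max}=\max_i\lambda_i$, $\psi_\alpha(\theta)=e^{\alpha\Lambda}\theta$, $\|\theta\|_\Lambda^2=\sum_i\lambda_i\theta_i^2$ and $\|\theta\|_{\Lambda_{\max}}^2=\sum_{i:\lambda_i=\lambda_{\max}}\lambda_i\theta_i^2$. If $\|\theta\|_\Lambda>0$, let $\hat\theta=\psi_{-\tau}(\theta)$, where $\tau$ is the unique real number with $\|\psi_{-\tau}(\theta)\|_\Lambda=1$. Say that $\theta$ separates the data if $s_{jc}(\theta)>0$ for all $j$ and all $c\ne y_j$. Assume: 1. (Quasi-homogeneity) $f(x;\psi_\alpha(\theta))=e^{\alpha}f(x;\theta)$ for all $\alpha\in\mathbb{R}$, $\theta\in\mathbb{R}^m$ and all inputs $x$. 2. (Regularity) For every input $x$ and every class $c$, $f_c(x;\cdot)$ is locally Lipschitz and admits a chain rule. 3. (Gradient flow) $\theta(t)$, $t\ge 0$, is an arc with $\frac{d\theta}{dt}\in-\partial^\circ\mathcal{L}(\theta(t))$ for almost every $t>0$. 4. (Strong separability) There is a time $t_0\ge 0$ with $\mathcal{L}(\theta(t_0))<n^{-1}\log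 2$. 5. (Normalized convergence) $\bar\theta:=\lim_{t\to\infty}\hat\theta(t)$ exists in $\mathbb{R}^m$, where $\hat\theta(t)$ is the normalization of $\theta(t)$. 6. (Conditional separability) There is a $\kappa>0$ such that every $\theta$ that separates the data satisfies $\|\hat\theta\|_{\Lambda_{\max}}\ge\kappa$. Then there is an $\alpha\in\mathbb{R}$ such that $\theta^*=\psi_\alpha(\bar\theta)$ is a first-order KKT point of $$\text{minimize }\ \tfrac12\|\theta\|_{\Lambda_{\max}}^2\quad\text{subject to}\quad \min_{c\ne y_j}s_{jc}(\theta)\ge 1\ \text{ for all } j\in\{1,\dots,n\},$$ where the constraints are read as the inequalities $s_{jc}(\theta)\ge 1$, one for each pair $(j,c)$ with $c\ne y_j$. That is, $s_{jc}(\theta^*)\ge 1$ for all such pairs, and there are multipliers $\mu_{jc}\ge 0$ and vectors $h_{jc}\in\partial^\circ s_{jc}(\theta^*)$ with $$\nabla\Big(\tfrac12\|\cdot\|_{\Lambda_{\max}}^2\Big)(\theta^*)=\sum_{j}\sum_{c\ne y_j}\mu_{jc}h_{jc},\qquad \mu_{jc}\,(s_{jc}(\theta^*)-1)=0\ \text{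 for all } j \text{ and all } c\ne y_j.$$ -/

import Mathlib

/-- Parameter space `ℝ^m` with its Euclidean norm. -/
abbrev Params (m : ℕ) : Type := EuclideanSpace ℝ (Fin m)

section Clarke

/-- Clarke's subdifferential of `F` at `θ`: the convex hull of all limits of gradients of `F`
along sequences of differentiability points that converge to `θ`. -/
def clarkeSubdifferential {m : ℕ} (F : Params m → ℝ) (θ : Params m) : Set (Params m) :=
  convexHull ℝ {g | ∃ u : ℕ → Params m, (∀ k, DifferentiableAt ℝ F (u k)) ∧
    Filter.Tendsto u Filter.atTop (nhds θ) ∧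
    Filter.Tendsto (fun k => gradient F (u k)) Filter.atTop (nhds g)}

/-- An arc `[0, ∞) → ℝ^m`: absolutely continuous on every compact subinterval of `[0, ∞)`
(values at negative times are irrelevant). -/
def IsArc {m : ℕ} (z : ℝ → Params m) : Prop :=
  ∀ T : ℝ, 0 < T → AbsolutelyContinuousOnInterval z 0 T

/-- `F` admits a chain rule: along every arc `z`, for almost every `t > 0`, the composition
`F ∘ z` has derivative `⟪h, z'(t)⟫` at `t` for every `h` in the Clarke subdifferential
of `F` at `z t`. -/
def AdmitsChainRule {m : ℕ} (F : Params m → ℝ) : Prop :=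
  ∀ z : ℝ → Params m, IsArc z →
    ∀ᵐ t ∂(MeasureTheory.volume.restrict (Set.Ioi (0 : ℝ))),
      ∀ h ∈ clarkeSubdifferential F (z t),
        HasDerivAt (fun s => F (z s)) (inner ℝ h (deriv z t)) t

/-- Gradient flow of the loss `L`: an arc `θ` with `dθ/dt ∈ -∂°L(θ(t))` for almost every
`t > 0`. -/
def IsGradientFlow {m : ℕ} (L : Params m → ℝ) (θ : ℝ → Params m) : Prop :=
  IsArc θ ∧ ∀ᵐ t ∂(MeasureTheory.volume.restrict (Set.Ioi (0 : ℝ))),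
    ∃ v : Params m, HasDerivAt θ v t ∧ -v ∈ clarkeSubdifferential L (θ t)

/-- First-order KKT point of: minimize `Φ θ` subject to `G i θ ≥ 1` for all `i`
(differentiable objective, locally Lipschitz constraints). -/
def IsKKTPoint {m : ℕ} {ι : Type*} [Fintype ι] (Φ : Params m → ℝ) (G : ι → Params m → ℝ)
    (θ : Params m) : Prop :=
  (∀ i, 1 ≤ G i θ) ∧
  ∃ (μ : ι → ℝ) (h : ι → Params m),
    (∀ i, 0 ≤ μ i) ∧
    (∀ i, h i ∈ clarkeSubdifferential (G i) θ) ∧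
    gradient Φ θ = ∑ i, μ i • h i ∧
    (∀ i, μ i * (G i θ - 1) = 0)

end Clarke

section QuasiHomogeneous

/-- `ψ_α(θ) = e^{αΛ} θ` for the diagonal matrix `Λ = diag(lam)`. -/
noncomputable def psi {m : ℕ} (lam : Fin m → ℝ) (α : ℝ) (θ : Params m) : Params m :=
  WithLp.toLp 2 (fun i => Real.exp (α * lam i) * θ i)

/-- `F` is `Λ`-quasi-homogeneous: `F(ψ_α(θ)) = e^α F(θ)` for all `α ∈ ℝ` and all `θ`. -/
def QuasiHomogeneous {m : ℕ} (lam : Fin m → ℝ) (F : Params m → ℝ) : Prop :=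
  ∀ (α : ℝ) (θ : Params m), F (psi lam α θ) = Real.exp α * F θ

/-- The `Λ`-seminorm, `‖θ‖_Λ² = ∑ i, λ_i θ_i²`. -/
noncomputable def lamSeminorm {m : ℕ} (lam : Fin m → ℝ) (θ : Params m) : ℝ :=
  Real.sqrt (∑ i, lam i * θ i ^ 2)

/-- The largest diagonal entry `λ_max`. -/
noncomputable def lamMax {m : ℕ} (lam : Fin m → ℝ) : ℝ := ⨆ i, lam i

open Classical in
/-- The `Λ_max`-seminorm, `‖θ‖_{Λ_max}² = ∑_{i : λ_i = λ_max} λ_i θ_i²`. -/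
noncomputable def lamMaxSeminorm {m : ℕ} (lam : Fin m → ℝ) (θ : Params m) : ℝ :=
  Real.sqrt (∑ i with lam i = lamMax lam, lam i * θ i ^ 2)

/-- Whenever `‖θ‖_Λ > 0` there is exactly one `τ` with `‖ψ_{-τ}(θ)‖_Λ² = 1`, so that the
normalization below is well defined. -/
theorem existsUnique_normalization {m : ℕ} (lam : Fin m → ℝ) (hlam : ∀ i, 0 ≤ lam i)
    (θ : Params m) (hθ : 0 < lamSeminorm lam θ) :
    ∃! τ : ℝ, lamSeminorm lam (psi lam (-τ) θ) ^ 2 = 1 := by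
  have key : ∀ τ : ℝ, lamSeminorm lam (psi lam (-τ) θ) ^ 2 =
      ∑ i, lam i * (Real.exp (-τ * lam i) * θ i) ^ 2 := by
    intro τ
    unfold lamSeminorm
    rw [Real.sq_sqrt (Finset.sum_nonneg fun i _ => mul_nonneg (hlam i) (sq_nonneg _))]
    rfl
  obtain ⟨j, hj⟩ : ∃ j, 0 < lam j * θ j ^ 2 := by
    by_contra! h
    have : ∑ i, lam i * θ i ^ 2 ≤ 0 := Finset.sum_nonpos fun i _ => h i
    rw [lamSeminorm, Real.sqrt_eq_zero_of_nonpos this] at hθ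
    exact lt_irrefl _ hθ
  have hlj : 0 < lam j := by
    rcases (hlam j).lt_or_eq with h | h
    · exact h
    · rw [← h] at hj; simp at hj
  have hθj : 0 < θ j ^ 2 := by
    by_contra! h
    nlinarith
  set F : ℝ → ℝ := fun τ => ∑ i, lam i * (Real.exp (-τ * lam i) * θ i) ^ 2 with hF
  have hcont : Continuous F := by
    rw [hF]; fun_prop
  have hanti : StrictAnti F := by
    intro a b hab
    refine Finset.sum_lt_sum (fun i _ => ?_) ⟨j, Finset.mem_univ j, ?_⟩
    · have h1 : Real.exp (-b * lam i) ≤ Real.exp (-a * lam i) :=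
        Real.exp_le_exp.2 (by nlinarith [hlam i])
      have h2 := pow_le_pow_left₀ (Real.exp_pos _).le h1 2
      simp only [mul_pow]
      exact mul_le_mul_of_nonneg_left (mul_le_mul_of_nonneg_right h2 (sq_nonneg _)) (hlam i)
    · have h1 : Real.exp (-b * lam j) < Real.exp (-a * lam j) :=
        Real.exp_lt_exp.2 (by nlinarith)
      have h2 := pow_lt_pow_left₀ h1 (Real.exp_pos _).le two_ne_zero
      simp only [mul_pow]
      exact mul_lt_mul_of_pos_left (mul_lt_mul_of_pos_right h2 hθj) hlj
  have hzero : Filter.Tendsto F Filter.atTop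
      (nhds (∑ i, if lam i = 0 then 0 else 0)) := by
    refine tendsto_finsetSum _ fun i _ => ?_
    rcases (hlam i).lt_or_eq with h | h
    · have h1 : Filter.Tendsto (fun τ : ℝ => Real.exp (-τ * lam i)) Filter.atTop (nhds 0) :=
        Real.tendsto_exp_atBot.comp
          (Filter.Tendsto.atBot_mul_const h Filter.tendsto_neg_atTop_atBot)
      have h2 := ((h1.mul_const (θ i)).pow 2).const_mul (lam i)
      simpa using h2
    · simp [← h]
  simp only [ite_self, Finset.sum_const_zero] at hzero
  have htop : Filter.Tendsto F Filter.atBot Filter.atTop := by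
    have h1 : Filter.Tendsto (fun τ : ℝ => Real.exp (-τ * lam j)) Filter.atBot Filter.atTop :=
      Real.tendsto_exp_atTop.comp
        (Filter.Tendsto.atTop_mul_const hlj Filter.tendsto_neg_atBot_atTop)
    have h2 : Filter.Tendsto (fun τ : ℝ => Real.exp (-τ * lam j) ^ 2 * (lam j * θ j ^ 2))
        Filter.atBot Filter.atTop :=
      Filter.Tendsto.atTop_mul_const hj ((Filter.tendsto_pow_atTop two_ne_zero).comp h1)
    refine Filter.tendsto_atTop_mono (fun τ => ?_) h2
    calc Real.exp (-τ * lam j) ^ 2 * (lam j * θ j ^ 2)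
        = lam j * (Real.exp (-τ * lam j) * θ j) ^ 2 := by ring
      _ ≤ F τ := Finset.single_le_sum (f := fun i => lam i * (Real.exp (-τ * lam i) * θ i) ^ 2)
          (fun i _ => mul_nonneg (hlam i) (sq_nonneg _)) (Finset.mem_univ j)
  obtain ⟨a, ha⟩ := (hzero.eventually (gt_mem_nhds one_pos)).exists
  obtain ⟨b, hb⟩ := (htop.eventually (Filter.eventually_ge_atTop 1)).exists
  obtain ⟨τ, hτ⟩ : ∃ τ, F τ = 1 :=
    mem_range_of_exists_le_of_exists_ge hcont ⟨a, ha.le⟩ ⟨b, hb⟩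
  refine ⟨τ, (key τ).trans hτ, fun σ hσ => hanti.injective ?_⟩
  exact ((key σ).symm.trans hσ).trans hτ.symm

open Classical in
/-- The `Λ`-normalized parameters `θ̂ = ψ_{-τ}(θ)`, where `τ` is determined by
`‖θ̂‖_Λ² = 1` (used only when `‖θ‖_Λ > 0`; the value is `θ` when no such `τ` exists). -/
noncomputable def lamNormalize {m : ℕ} (lam : Fin m → ℝ) (θ : Params m) : Params m :=
  if h : ∃ τ : ℝ, lamSeminorm lam (psi lam (-τ) θ) ^ 2 = 1 then psi lam (-h.choose) θ else θ

end QuasiHomogeneous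

section Classification

/-- The cross-entropy loss
`L(θ) = -n⁻¹ ∑_j log (exp f_{y_j}(x_j; θ) / ∑_c exp f_c(x_j; θ))`. -/
noncomputable def crossEntropyLoss {X : Type*} {m n C : ℕ} (f : X → Params m → Fin C → ℝ)
    (x : Fin n → X) (y : Fin n → Fin C) (θ : Params m) : ℝ :=
  -((n : ℝ)⁻¹ * ∑ j, Real.log
    (Real.exp (f (x j) θ (y j)) / ∑ c, Real.exp (f (x j) θ c)))

/-- The score gap `s_{jc}(θ) = f_{y_j}(x_j; θ) - f_c(x_j; θ)`. -/
def scoreGap {X : Type*} {m n C : ℕ} (f : X → Params m → Fin C → ℝ)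
    (x : Fin n → X) (y : Fin n → Fin C) (j : Fin n) (c : Fin C) (θ : Params m) : ℝ :=
  f (x j) θ (y j) - f (x j) θ c

/-- `θ` separates the training data: every data point is strictly correctly classified. -/
def Separates {X : Type*} {m n C : ℕ} (f : X → Params m → Fin C → ℝ)
    (x : Fin n → X) (y : Fin n → Fin C) (θ : Params m) : Prop :=
  ∀ (j : Fin n) (c : Fin C), c ≠ y j → 0 < scoreGap f x y j c θ

/-- First-order KKT point of: minimize `½ ‖θ‖_{Λ_max}²` subject to
`min_{c ≠ y_j} s_{jc}(θ) ≥ 1` for all `j`, where the minimum constraint stands for the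
constraints `s_{jc}(θ) ≥ 1`, one for each pair `(j, c)` with `c ≠ y_j`. -/
def IsMaxMarginKKTPoint {X : Type*} {m n C : ℕ} (lam : Fin m → ℝ)
    (f : X → Params m → Fin C → ℝ) (x : Fin n → X) (y : Fin n → Fin C)
    (θ : Params m) : Prop :=
  IsKKTPoint (fun ϑ => 1 / 2 * lamMaxSeminorm lam ϑ ^ 2)
    (fun (p : {p : Fin n × Fin C // p.2 ≠ y p.1}) ϑ => scoreGap f x y p.1.1 p.1.2 ϑ) θ

end Classification

/-! ### Convex hulls in finite dimension -/

section ConvexHull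

/-- In finite dimension the convex hull of a compact set is compact. -/
theorem IsCompact.convexHull_of_finiteDimensional {E : Type*} [NormedAddCommGroup E]
    [NormedSpace ℝ E] [FiniteDimensional ℝ E] {s : Set E} (hs : IsCompact s) :
    IsCompact (convexHull ℝ s) := by
  classical
  rcases s.eq_empty_or_nonempty with rfl | ⟨p, hp⟩
  · simp
  -- Carathéodory: `d` points suffice, so the hull is a continuous image of the compact set simplex
  -- × s^d. The point `p` fills unused slots, with weight 0.
  set d := Module.finrank ℝ E + 1 with hd
  have himage : convexHull ℝ s =
      (fun q : (Fin d → ℝ) × (Fin d → E) => ∑ i, q.1 i • q.2 i) ''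
        (stdSimplex ℝ (Fin d) ×ˢ Set.univ.pi fun _ => s) := by
    apply Set.Subset.antisymm
    · intro x hx
      obtain ⟨ι, hι, z, w, hz, hind, hw, hw1, rfl⟩ := eq_pos_convex_span_of_mem_convexHull hx
      have hcard : Fintype.card ι ≤ Fintype.card (Fin d) := by
        rw [Fintype.card_fin]
        exact hind.card_le_finrank_succ.trans
          (Nat.add_le_add_right (Submodule.finrank_le _) 1)
      obtain ⟨e⟩ := Function.Embedding.nonempty_of_card_le hcard
      refine ⟨(fun j => if h : ∃ i, e i = j then w h.choose else 0,
        fun j => if h : ∃ i, e i = j then z h.choose else p), ⟨⟨fun j => ?_, ?_⟩, fun j _ => ?_⟩, ?_⟩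
      · dsimp only
        split_ifs
        · exact (hw _).le
        · exact le_rfl
      · rw [← hw1]
        refine (Finset.sum_of_injOn e e.injective.injOn (by simp)
          (fun j _ hj => dif_neg (by simpa using hj)) (fun i _ => ?_)).symm
        have h : ∃ i', e i' = e i := ⟨i, rfl⟩
        simp only [dif_pos h, e.injective h.choose_spec]
      · dsimp only
        split_ifs
        · exact hz ⟨_, rfl⟩
        · exact hp
      · refine (Finset.sum_of_injOn e e.injective.injOn (by simp) (fun j _ hj => ?_)
          (fun i _ => ?_)).symm
        · have hj' : ¬ ∃ i, e i = j := by simpa using hj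
          simp only [dif_neg hj', zero_smul]
        · have h : ∃ i', e i' = e i := ⟨i, rfl⟩
          simp only [dif_pos h, e.injective h.choose_spec]
    · rintro _ ⟨⟨w, z⟩, ⟨⟨hw, hw1⟩, hz⟩, rfl⟩
      exact mem_convexHull_of_exists_fintype w z hw hw1 (fun i => hz i trivial) rfl
  rw [himage]
  exact ((isCompact_stdSimplex ℝ (Fin d)).prod (isCompact_univ_pi fun _ => hs)).image (by fun_prop)

/-- A point of the convex hull of a finite union of nonempty convex sets is a convex combination
of one point from each of them. -/
theorem exists_sum_of_mem_convexHull_iUnion {E ι : Type*} [AddCommGroup E] [Module ℝ E]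
    [Fintype ι] {A : ι → Set E} (hconv : ∀ k, Convex ℝ (A k)) (hne : ∀ k, (A k).Nonempty)
    (P : ι → Prop) {x : E} (hx : x ∈ convexHull ℝ (⋃ k, ⋃ _ : P k, A k)) :
    ∃ (w : ι → ℝ) (z : ι → E), (∀ k, 0 ≤ w k) ∧ (∀ k, z k ∈ A k) ∧ (∀ k, ¬ P k → w k = 0) ∧
      ∑ k, w k • z k = x := by
  classical
  obtain ⟨κ, _, w, z, hw, -, hz, rfl⟩ := mem_convexHull_iff_exists_fintype.1 hx
  have hz' : ∀ i, ∃ k, P k ∧ z i ∈ A k := fun i => by simpa using hz i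
  choose r hrP hrA using hz'
  -- Points assigned to the same set are merged into their barycentre; where the total weight is 0,
  -- any point of the set serves.
  have key : ∀ k, ∃ y ∈ A k,
      (∑ i with r i = k, w i) • y = ∑ i with r i = k, w i • z i := by
    intro k
    by_cases h0 : ∑ i with r i = k, w i = 0
    · obtain ⟨y, hy⟩ := hne k
      refine ⟨y, hy, ?_⟩
      rw [h0, zero_smul]
      refine (Finset.sum_eq_zero fun i hi => ?_).symm
      rw [(Finset.sum_eq_zero_iff_of_nonneg fun i _ => hw i).1 h0 i hi, zero_smul]
    · refine ⟨(Finset.univ.filter fun i => r i = k).centerMass w z,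
        (hconv k).centerMass_mem (fun i _ => hw i)
          (lt_of_le_of_ne (Finset.sum_nonneg fun i _ => hw i) (Ne.symm h0)) fun i hi => ?_, ?_⟩
      · rw [← (Finset.mem_filter.1 hi).2]
        exact hrA i
      · rw [Finset.centerMass, smul_inv_smul₀ h0]
  choose y hyA hy using key
  refine ⟨fun k => ∑ i with r i = k, w i, y, fun k => Finset.sum_nonneg fun i _ => hw i, hyA,
    fun k hk => ?_, ?_⟩
  · refine Finset.sum_eq_zero fun i hi => ?_
    rw [← (Finset.mem_filter.1 hi).2] at hk
    exact absurd (hrP i) hk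
  · simp only [hy]
    exact Finset.sum_fiberwise Finset.univ r fun i => w i • z i

end ConvexHull

/-! ### Absolutely continuous curves -/

section AbsolutelyContinuous

open MeasureTheory

theorem LipschitzOnWith.comp_absolutelyContinuousOnInterval {X Y : Type*} [PseudoMetricSpace X]
    [PseudoMetricSpace Y] {F : X → Y} {K : NNReal} {s : Set X} {z : ℝ → X} {a b : ℝ}
    (hF : LipschitzOnWith K F s) (hz : AbsolutelyContinuousOnInterval z a b)
    (hs : Set.MapsTo z (Set.uIcc a b) s) :
    AbsolutelyContinuousOnInterval (fun t => F (z t)) a b := by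
  rw [absolutelyContinuousOnInterval_iff] at hz ⊢
  intro ε hε
  obtain ⟨δ, hδ, h⟩ := hz (ε / (K + 1)) (by positivity)
  refine ⟨δ, hδ, fun E hE hEδ => ?_⟩
  have h1 := h E hE hEδ
  have hmem : ∀ i ∈ Finset.range E.1, (E.2 i).1 ∈ Set.uIcc a b ∧ (E.2 i).2 ∈ Set.uIcc a b :=
    fun i hi => hE.1 i hi
  calc ∑ i ∈ Finset.range E.1, dist (F (z (E.2 i).1)) (F (z (E.2 i).2))
      ≤ ∑ i ∈ Finset.range E.1, (K : ℝ) * dist (z (E.2 i).1) (z (E.2 i).2) :=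
        Finset.sum_le_sum fun i hi => hF.dist_le_mul _ (hs (hmem i hi).1) _ (hs (hmem i hi).2)
    _ = K * ∑ i ∈ Finset.range E.1, dist (z (E.2 i).1) (z (E.2 i).2) := by rw [Finset.mul_sum]
    _ ≤ K * (ε / (K + 1)) := by gcongr
    _ < (K + 1) * (ε / (K + 1)) := by
        have : 0 < ε / ((K : ℝ) + 1) := by positivity
        nlinarith
    _ = ε := by field_simp

/-- Composition with a map that is locally Lipschitz along the curve preserves absolute
continuity. -/
theorem AbsolutelyContinuousOnInterval.comp_locallyLipschitz {X Y : Type*}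
    [NormedAddCommGroup X] [PseudoMetricSpace Y] {F : X → Y} {z : ℝ → X} {a b : ℝ}
    (hz : AbsolutelyContinuousOnInterval z a b)
    (hF : ∀ t ∈ Set.uIcc a b, ∃ K, ∃ s ∈ nhds (z t), LipschitzOnWith K F s) :
    AbsolutelyContinuousOnInterval (fun t => F (z t)) a b := by
  have hl : LocallyLipschitzOn (z '' Set.uIcc a b) F := by
    rintro _ ⟨t, ht, rfl⟩
    obtain ⟨K, s, hs, h⟩ := hF t ht
    exact ⟨K, s, mem_nhdsWithin_of_mem_nhds hs, h⟩
  obtain ⟨K, hK⟩ := hl.exists_lipschitzOnWith_of_compact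
    (isCompact_uIcc.image_of_continuousOn hz.continuousOn)
  exact hK.comp_absolutelyContinuousOnInterval hz (Set.mapsTo_image z _)

/-- An absolutely continuous function whose derivative is almost everywhere at least `c` grows at
least linearly with slope `c`. -/
theorem AbsolutelyContinuousOnInterval.mul_sub_le_of_ae_hasDerivAt {g : ℝ → ℝ} {a b c : ℝ}
    (hab : a ≤ b) (hg : AbsolutelyContinuousOnInterval g a b)
    (h : ∀ᵐ t, t ∈ Set.Ioc a b → ∃ d, HasDerivAt g d t ∧ c ≤ d) :
    c * (b - a) ≤ g b - g a := by
  rw [← hg.integral_deriv_eq_sub]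
  have h1 : ∫ _ in a..b, c = c * (b - a) := by simp [mul_comm]
  rw [← h1]
  refine intervalIntegral.integral_mono_ae_restrict hab (by simp) hg.intervalIntegrable_deriv ?_
  have h2 : ∀ᵐ t, t ∈ Set.Icc a b → t ∈ Set.Ioc a b := by
    filter_upwards [(Set.finite_singleton a).countable.ae_notMem volume] with t ht hmem
    exact ⟨lt_of_le_of_ne hmem.1 (Ne.symm ht), hmem.2⟩
  rw [Filter.EventuallyLE, ae_restrict_iff' measurableSet_Icc]
  filter_upwards [h, h2] with t ht ht2 hmem
  obtain ⟨d, hd, hcd⟩ := ht (ht2 hmem)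
  rw [hd.deriv]
  exact hcd

theorem AbsolutelyContinuousOnInterval.le_of_ae_hasDerivAt_nonneg {g : ℝ → ℝ} {a b : ℝ}
    (hab : a ≤ b) (hg : AbsolutelyContinuousOnInterval g a b)
    (h : ∀ᵐ t, t ∈ Set.Ioc a b → ∃ d, HasDerivAt g d t ∧ 0 ≤ d) : g a ≤ g b := by
  have := hg.mul_sub_le_of_ae_hasDerivAt hab h
  linarith

end AbsolutelyContinuous

/-! ### Clarke subdifferentials through their support functions -/

section ClarkeCalculus

open Filter Topology MeasureTheory

variable {m : ℕ}

/-- The limits of gradients of `F` along sequences of differentiability points converging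
to `x`. -/
def limitingGradients (F : Params m → ℝ) (x : Params m) : Set (Params m) :=
  {g | ∃ u : ℕ → Params m, (∀ k, DifferentiableAt ℝ F (u k)) ∧
    Tendsto u atTop (𝓝 x) ∧ Tendsto (fun k => gradient F (u k)) atTop (𝓝 g)}

theorem limitingGradients_subset (F : Params m → ℝ) (x : Params m) :
    limitingGradients F x ⊆ clarkeSubdifferential F x :=
  subset_convexHull ℝ _

theorem eventually_norm_gradient_le {F : Params m → ℝ} (hF : LocallyLipschitz F) (x : Params m) :
    ∃ K : ℝ, ∀ᶠ u in 𝓝 x, ‖gradient F u‖ ≤ K := by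
  obtain ⟨K, s, hs, h⟩ := hF x
  refine ⟨K, ?_⟩
  filter_upwards [eventually_mem_nhds_iff.2 hs] with u hu
  rw [gradient, LinearIsometryEquiv.norm_map]
  exact norm_fderiv_le_of_lipschitzOn ℝ hu h

/-- Gradients are bounded near `x` by the local Lipschitz constant, so a subsequence of them
converges. This turns any failure of a bound near `x` into a limiting gradient at `x`. -/
theorem exists_seq_of_frequently {F : Params m → ℝ} (hF : LocallyLipschitz F) {x : Params m}
    {Q : Params m → Prop} (h : ∃ᶠ u in 𝓝 x, DifferentiableAt ℝ F u ∧ Q u) :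
    ∃ (u : ℕ → Params m) (g : Params m), (∀ k, DifferentiableAt ℝ F (u k)) ∧ (∀ k, Q (u k)) ∧
      Tendsto u atTop (𝓝 x) ∧ Tendsto (fun k => gradient F (u k)) atTop (𝓝 g) := by
  obtain ⟨K, hK⟩ := eventually_norm_gradient_le hF x
  obtain ⟨u, hu, hux⟩ := exists_seq_forall_of_frequently (h.and_eventually hK)
  obtain ⟨g, -, φ, hφ, hg⟩ := (isCompact_closedBall (0 : Params m) K).tendsto_subseq
    (x := fun k => gradient F (u k)) (fun k => by simpa using (hux k).2)
  exact ⟨u ∘ φ, g, fun k => (hux _).1.1, fun k => (hux _).1.2, hu.comp hφ.tendsto_atTop, hg⟩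

theorem ae_differentiableAt_of_locallyLipschitz {F : Params m → ℝ} (hF : LocallyLipschitz F) :
    ∀ᵐ x : Params m, DifferentiableAt ℝ F x := by
  refine measure_null_of_locally_null _ fun x _ => ?_
  obtain ⟨K, s, hs, h⟩ := hF x
  obtain ⟨t, hts, hto, hxt⟩ := mem_nhds_iff.1 hs
  refine ⟨{x | ¬ DifferentiableAt ℝ F x} ∩ t,
    inter_mem_nhdsWithin _ (hto.mem_nhds hxt), ?_⟩
  have h1 := (h.mono hts).ae_differentiableWithinAt_of_mem (μ := volume)
  refine measure_mono_null (fun y hy => ?_) h1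
  intro hy'
  exact hy.1 ((hy' hy.2).differentiableAt (hto.mem_nhds hy.2))

theorem limitingGradients_nonempty {F : Params m → ℝ} (hF : LocallyLipschitz F) (x : Params m) :
    (limitingGradients F x).Nonempty := by
  have hfreq : ∃ᶠ u in 𝓝 x, DifferentiableAt ℝ F u ∧ True := by
    have hd := Measure.dense_of_ae (ae_differentiableAt_of_locallyLipschitz hF)
    simpa using mem_closure_iff_frequently.1 (hd x)
  obtain ⟨u, g, hd, -, hu, hg⟩ := exists_seq_of_frequently hF hfreq
  exact ⟨g, u, hd, hu, hg⟩

theorem clarkeSubdifferential_nonempty {F : Params m → ℝ} (hF : LocallyLipschitz F)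
    (x : Params m) : (clarkeSubdifferential F x).Nonempty :=
  (limitingGradients_nonempty hF x).mono (limitingGradients_subset F x)

theorem isCompact_limitingGradients {F : Params m → ℝ} (hF : LocallyLipschitz F) (x : Params m) :
    IsCompact (limitingGradients F x) := by
  obtain ⟨K, hK⟩ := eventually_norm_gradient_le hF x
  refine (isCompact_closedBall (0 : Params m) K).of_isClosed_subset ?_ ?_
  · refine isClosed_of_closure_subset fun g hg => ?_
    -- Closedness by a diagonal sequence.
    have key : ∀ k : ℕ, ∃ u : Params m, DifferentiableAt ℝ F u ∧ dist u x < 1 / ((k : ℝ) + 1) ∧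
        dist (gradient F u) g < 1 / ((k : ℝ) + 1) := by
      intro k
      have hk : (0 : ℝ) < 1 / ((k : ℝ) + 1) := by positivity
      obtain ⟨g', ⟨u, hd, hu, hgu⟩, hg'⟩ := Metric.mem_closure_iff.1 hg _ (half_pos hk)
      have h1 := (Metric.tendsto_nhds.1 hu _ hk).and (Metric.tendsto_nhds.1 hgu _ (half_pos hk))
      obtain ⟨i, hi1, hi2⟩ := h1.exists
      refine ⟨u i, hd i, hi1, ?_⟩
      have := dist_triangle (gradient F (u i)) g' g
      rw [dist_comm] at hg'
      linarith
    choose u hd hu hgu using key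
    refine ⟨u, hd, ?_, ?_⟩
    · exact tendsto_iff_dist_tendsto_zero.2 (squeeze_zero (fun _ => dist_nonneg)
        (fun k => (hu k).le) tendsto_one_div_add_atTop_nhds_zero_nat)
    · exact tendsto_iff_dist_tendsto_zero.2 (squeeze_zero (fun _ => dist_nonneg)
        (fun k => (hgu k).le) tendsto_one_div_add_atTop_nhds_zero_nat)
  · rintro g ⟨u, -, hu, hg⟩
    rw [mem_closedBall_zero_iff]
    exact le_of_tendsto hg.norm (hu.eventually hK)

theorem isCompact_clarkeSubdifferential {F : Params m → ℝ} (hF : LocallyLipschitz F)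
    (x : Params m) : IsCompact (clarkeSubdifferential F x) :=
  (isCompact_limitingGradients hF x).convexHull_of_finiteDimensional

theorem convex_clarkeSubdifferential (F : Params m → ℝ) (x : Params m) :
    Convex ℝ (clarkeSubdifferential F x) :=
  convex_convexHull ℝ _

/-- The bound cuts out a half-space, so it only has to be checked on limits of gradients. The vector
and the bound may vary with the point, as Euler's identity requires with `v u` = Λu. -/
theorem le_inner_of_mem_clarkeSubdifferential {F : Params m → ℝ} {x : Params m}
    {v : Params m → Params m} {c : Params m → ℝ} (hv : ContinuousAt v x) (hc : ContinuousAt c x)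
    (h : ∀ᶠ u in 𝓝 x, DifferentiableAt ℝ F u → c u ≤ inner ℝ (v u) (gradient F u)) {g : Params m}
    (hg : g ∈ clarkeSubdifferential F x) : c x ≤ inner ℝ (v x) g := by
  have hconv : Convex ℝ {g : Params m | c x ≤ inner ℝ (v x) g} :=
    convex_halfSpace_ge (innerₛₗ ℝ (v x)).isLinear (c x)
  refine convexHull_min ?_ hconv hg
  rintro g ⟨u, hd, hu, hgu⟩
  refine le_of_tendsto_of_tendsto (hc.tendsto.comp hu) ((hv.tendsto.comp hu).inner hgu) ?_
  filter_upwards [hu.eventually h] with k hk using hk (hd k)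

/-- Upper semicontinuity of the Clarke subdifferential, in terms of support functions. -/
theorem eventually_le_inner_clarkeSubdifferential {F : Params m → ℝ} (hF : LocallyLipschitz F)
    {x v : Params m} {c : ℝ} (h : ∀ g ∈ clarkeSubdifferential F x, c < inner ℝ v g) :
    ∀ᶠ u in 𝓝 x, ∀ g ∈ clarkeSubdifferential F u, c ≤ inner ℝ v g := by
  have h1 : ∀ᶠ u in 𝓝 x, DifferentiableAt ℝ F u → c ≤ inner ℝ v (gradient F u) := by
    by_contra hcon
    have hfreq : ∃ᶠ u in 𝓝 x, DifferentiableAt ℝ F u ∧ inner ℝ v (gradient F u) < c := by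
      rw [Filter.Frequently]
      convert hcon using 3
      push Not
      rfl
    obtain ⟨u, g, hd, hQ, hu, hg⟩ := exists_seq_of_frequently hF hfreq
    have h2 : inner ℝ v g ≤ c :=
      le_of_tendsto (tendsto_const_nhds.inner hg) (Eventually.of_forall fun k => (hQ k).le)
    exact absurd (h g (limitingGradients_subset F x ⟨u, hd, hu, hg⟩)) (not_lt.2 h2)
  filter_upwards [eventually_eventually_nhds.2 h1] with u hu g hg
  exact le_inner_of_mem_clarkeSubdifferential (v := fun _ => v) (c := fun _ => c)
    continuousAt_const continuousAt_const hu hg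

theorem hasDerivAt_comp_line {F : Params m → ℝ} {y v : Params m} {t : ℝ}
    (hd : DifferentiableAt ℝ F (y + t • v)) :
    HasDerivAt (fun s : ℝ => F (y + s • v)) (inner ℝ v (gradient F (y + t • v))) t := by
  have h1 : HasDerivAt (fun s : ℝ => y + s • v) v t := by
    simpa using ((hasDerivAt_id t).smul_const v).const_add y
  have h2 := hd.hasGradientAt.hasFDerivAt.comp_hasDerivAt t h1
  rw [real_inner_comm]
  simpa [Function.comp_def] using h2

/-- Lower bounds for the directional derivative of a locally Lipschitz function that hold almost
everywhere on an open set hold at every differentiability point of that set. -/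
theorem le_inner_gradient_of_ae {F : Params m → ℝ} (hF : LocallyLipschitz F) {v : Params m}
    {c : ℝ} {O : Set (Params m)} (hO : IsOpen O)
    (h : ∀ᵐ w : Params m, w ∈ O → c ≤ inner ℝ v (gradient F w))
    {x : Params m} (hx : x ∈ O) (hd : DifferentiableAt ℝ F x) :
    c ≤ inner ℝ v (gradient F x) := by
  have hgood : ∀ᵐ w : Params m, DifferentiableAt ℝ F w ∧ (w ∈ O → c ≤ inner ℝ v (gradient F w)) :=
    (ae_differentiableAt_of_locallyLipschitz hF).and h
  -- Fubini needs a measurable set of good points of full measure.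
  obtain ⟨S, hSsub, hSmeas, hSae⟩ : ∃ S : Set (Params m),
      (∀ w ∈ S, DifferentiableAt ℝ F w ∧ (w ∈ O → c ≤ inner ℝ v (gradient F w))) ∧
      MeasurableSet S ∧ ∀ᵐ w : Params m, w ∈ S := by
    obtain ⟨S, hS1, hS2, hS3⟩ := (ae_iff.1 hgood) ▸ exists_measurable_superset volume
      {w | ¬ (DifferentiableAt ℝ F w ∧ (w ∈ O → c ≤ inner ℝ v (gradient F w)))}
    refine ⟨Sᶜ, fun w hw => ?_, hS2.compl, ?_⟩
    · by_contra hcon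
      exact hw (hS1 hcon)
    · rw [ae_iff]
      simpa using hS3
  -- Almost every line parallel to `v` meets the bad set in a null set. On such lines the derivative
  -- bound integrates; continuity then carries the integrated bound to the line through `x`.
  have hlines : ∀ᵐ y : Params m, ∀ᵐ s : ℝ, y + s • v ∈ S := by
    rw [Measure.ae_ae_comm (p := fun (y : Params m) (s : ℝ) => y + s • v ∈ S)]
    · refine Eventually.of_forall fun s => ?_
      exact (measurePreserving_add_right volume (s • v)).quasiMeasurePreserving.ae hSae
    · exact hSmeas.preimage
        (by fun_prop : Measurable fun q : Params m × ℝ => q.1 + q.2 • v)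
  obtain ⟨r, hr, hrO⟩ := Metric.isOpen_iff.1 hO x hx
  have hgrow : ∀ t : ℝ, 0 ≤ t → t * ‖v‖ < r / 2 → c * t ≤ F (x + t • v) - F x := by
    intro t ht htr
    have hline : ∀ y ∈ Metric.ball x (r / 2), (∀ᵐ s : ℝ, y + s • v ∈ S) →
        c * t ≤ F (y + t • v) - F y := by
      intro y hy hys
      have hac : AbsolutelyContinuousOnInterval (fun s : ℝ => F (y + s • v)) 0 t := by
        have h1 : AbsolutelyContinuousOnInterval (fun s : ℝ => y + s • v) 0 t :=
          ContDiffOn.absolutelyContinuousOnInterval (by fun_prop)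
        exact h1.comp_locallyLipschitz fun s _ => hF _
      have := hac.mul_sub_le_of_ae_hasDerivAt (c := c) ht ?_
      · simpa using this
      · filter_upwards [hys] with s hs hst
        refine ⟨_, hasDerivAt_comp_line (hSsub _ hs).1, (hSsub _ hs).2 (hrO ?_)⟩
        rw [Metric.mem_ball, dist_eq_norm] at hy ⊢
        have h2 : y + s • v - x = (y - x) + s • v := by abel
        have h3 : ‖s • v‖ ≤ t * ‖v‖ := by
          rw [norm_smul, Real.norm_of_nonneg hst.1.le]
          gcongr
          exact hst.2
        rw [h2]
        have := norm_add_le (y - x) (s • v)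
        linarith
    have hdense := Measure.dense_of_ae hlines
    have hfreq : ∃ᶠ y in 𝓝 x, c * t ≤ F (y + t • v) - F y := by
      refine ((mem_closure_iff_frequently.1 (hdense x)).and_eventually
        (Metric.ball_mem_nhds x (half_pos hr))).mono fun y hy => hline y hy.2 hy.1
    have hcl : IsClosed {y | c * t ≤ F (y + t • v) - F y} := by
      have := hF.continuous
      exact isClosed_le continuous_const (by fun_prop)
    exact hcl.closure_subset (mem_closure_iff_frequently.2 hfreq)
  have hder : HasDerivAt (fun s : ℝ => F (x + s • v)) (inner ℝ v (gradient F x)) 0 := by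
    have h0 : DifferentiableAt ℝ F (x + (0 : ℝ) • v) := by simpa using hd
    simpa using hasDerivAt_comp_line h0
  have hslope := (hasDerivAt_iff_tendsto_slope.1 hder).mono_left
    (nhdsWithin_mono 0 (fun s (hs : s ∈ Set.Ioi (0 : ℝ)) => (Set.mem_Ioi.1 hs).ne'))
  refine ge_of_tendsto hslope ?_
  have hsmall : ∀ᶠ t in 𝓝[>] (0 : ℝ), t * ‖v‖ < r / 2 := by
    have : Tendsto (fun t : ℝ => t * ‖v‖) (𝓝 0) (𝓝 0) := by
      simpa using (continuous_id.mul continuous_const).tendsto (0 : ℝ) (f := fun t : ℝ => t * ‖v‖)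
    exact (this.eventually (gt_mem_nhds (half_pos hr))).filter_mono nhdsWithin_le_nhds
  filter_upwards [hsmall, self_mem_nhdsWithin] with t ht ht0
  have ht0' : (0 : ℝ) < t := ht0
  have := hgrow t ht0'.le ht
  rw [slope_def_field, le_div_iff₀ (by simpa using ht0')]
  simpa using this

/-- Chain rule inclusion `∂°L ⊆ ∑ w_k ∂°F_k`, in terms of support functions. -/
theorem sum_le_inner_of_mem_clarkeSubdifferential {ι : Type*} [Fintype ι]
    {F : ι → Params m → ℝ} {L : Params m → ℝ} {w : ι → Params m → ℝ}
    (hF : ∀ k, LocallyLipschitz (F k)) (hL : LocallyLipschitz L) (hw : ∀ k, Continuous (w k))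
    (hgrad : ∀ u, (∀ k, DifferentiableAt ℝ (F k) u) →
      gradient L u = ∑ k, w k u • gradient (F k) u)
    {x v : Params m} {b : ι → ℝ}
    (hb : ∀ k, ∀ g ∈ clarkeSubdifferential (F k) x, b k ≤ w k x * inner ℝ v g)
    {h : Params m} (hh : h ∈ clarkeSubdifferential L x) : ∑ k, b k ≤ inner ℝ v h := by
  refine le_of_forall_pos_le_add fun ε hε => ?_
  set δ : ℝ := ε / (Fintype.card ι + 1) with hδ
  have hδ0 : 0 < δ := by positivity
  have hnear : ∀ k, ∀ᶠ u in 𝓝 x, DifferentiableAt ℝ (F k) u →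
      b k - δ ≤ w k u * inner ℝ v (gradient (F k) u) := by
    intro k
    by_contra hcon
    have hfreq : ∃ᶠ u in 𝓝 x, DifferentiableAt ℝ (F k) u ∧
        w k u * inner ℝ v (gradient (F k) u) < b k - δ := by
      rw [Filter.Frequently]
      convert hcon using 3
      push Not
      rfl
    obtain ⟨u, g, hd, hQ, hu, hg⟩ := exists_seq_of_frequently (hF k) hfreq
    have h2 : w k x * inner ℝ v g ≤ b k - δ :=
      le_of_tendsto ((((hw k).tendsto x).comp hu).mul (tendsto_const_nhds.inner hg))
        (Eventually.of_forall fun i => (hQ i).le)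
    have h3 := hb k g (limitingGradients_subset _ x ⟨u, hd, hu, hg⟩)
    linarith
  obtain ⟨O, hOsub, hO, hxO⟩ := eventually_nhds_iff.1 (eventually_all.2 hnear)
  -- `L` may be differentiable where some `F k` is not, so the gradient formula is available only
  -- almost everywhere (Rademacher); `le_inner_gradient_of_ae` removes the exceptional set.
  have hsum : ∀ᵐ u : Params m, u ∈ O → ∑ k, b k - ε ≤ inner ℝ v (gradient L u) := by
    filter_upwards [eventually_all.2 fun k => ae_differentiableAt_of_locallyLipschitz (hF k)]
      with u hu huO
    rw [hgrad u hu, inner_sum]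
    have h1 : ∑ k, (b k - δ) ≤ ∑ k, inner ℝ v (w k u • gradient (F k) u) := by
      refine Finset.sum_le_sum fun k _ => ?_
      rw [inner_smul_right]
      exact hOsub u huO k (hu k)
    have h2 : (Fintype.card ι : ℝ) * δ ≤ ε := by
      rw [hδ, mul_div_assoc', div_le_iff₀ (by positivity)]
      nlinarith
    simp only [Finset.sum_sub_distrib, Finset.sum_const, Finset.card_univ, nsmul_eq_mul] at h1
    linarith
  have := le_inner_of_mem_clarkeSubdifferential (v := fun _ => v)
    (c := fun _ => ∑ k, b k - ε) continuousAt_const continuousAt_const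
    ((hO.eventually_mem hxO).mono fun u hu hd => le_inner_gradient_of_ae hL hO hsum hu hd) hh
  linarith

/-- If all elements of `∂°F_k(x)` take the same value `d_k` on `v`, then all elements of `∂°L(x)`
take the value `∑ w_k d_k` on `v`. -/
theorem inner_eq_sum_of_mem_clarkeSubdifferential {ι : Type*} [Fintype ι]
    {F : ι → Params m → ℝ} {L : Params m → ℝ} {w : ι → Params m → ℝ}
    (hF : ∀ k, LocallyLipschitz (F k)) (hL : LocallyLipschitz L) (hw : ∀ k, Continuous (w k))
    (hgrad : ∀ u, (∀ k, DifferentiableAt ℝ (F k) u) →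
      gradient L u = ∑ k, w k u • gradient (F k) u)
    {x v : Params m} {d : ι → ℝ}
    (hd : ∀ k, ∀ g ∈ clarkeSubdifferential (F k) x, inner ℝ v g = d k)
    {h : Params m} (hh : h ∈ clarkeSubdifferential L x) : inner ℝ v h = ∑ k, w k x * d k := by
  refine le_antisymm ?_ ?_
  · have := sum_le_inner_of_mem_clarkeSubdifferential hF hL hw hgrad (v := -v)
      (b := fun k => -(w k x * d k)) (fun k g hg => by rw [inner_neg_left, hd k g hg]; linarith) hh
    rw [inner_neg_left, Finset.sum_neg_distrib] at this
    linarith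
  · exact sum_le_inner_of_mem_clarkeSubdifferential hF hL hw hgrad
      (fun k g hg => by rw [hd k g hg]) hh

end ClarkeCalculus

/-! ### Quasi-homogeneous functions: scaling of subgradients and Euler's identity -/

section QuasiHomogeneity

open Filter Topology

variable {m : ℕ} (lam : Fin m → ℝ)

@[simp]
theorem psi_apply (α : ℝ) (θ : Params m) (i : Fin m) :
    psi lam α θ i = Real.exp (α * lam i) * θ i :=
  rfl

theorem psi_psi (α β : ℝ) (θ : Params m) : psi lam α (psi lam β θ) = psi lam (α + β) θ := by
  ext i
  simp only [psi_apply, add_mul, Real.exp_add, mul_assoc]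

@[simp]
theorem psi_zero (θ : Params m) : psi lam 0 θ = θ := by
  ext i
  simp

theorem psi_neg_psi (α : ℝ) (θ : Params m) : psi lam (-α) (psi lam α θ) = θ := by
  rw [psi_psi, neg_add_cancel, psi_zero]

theorem psi_psi_neg (α : ℝ) (θ : Params m) : psi lam α (psi lam (-α) θ) = θ := by
  rw [psi_psi, add_neg_cancel, psi_zero]

theorem continuous_psi : Continuous fun q : ℝ × Params m => psi lam q.1 q.2 := by
  refine (PiLp.continuous_toLp 2 _).comp (continuous_pi fun i => ?_)
  fun_prop

theorem inner_psi_left (α : ℝ) (u v : Params m) :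
    inner ℝ (psi lam α u) v = inner ℝ u (psi lam α v) := by
  simp only [PiLp.inner_apply, psi_apply, RCLike.inner_apply, conj_trivial]
  exact Finset.sum_congr rfl fun i _ => by ring

/-- The continuous linear map `ψ_α`. -/
noncomputable def psiCLM (α : ℝ) : Params m →L[ℝ] Params m :=
  LinearMap.toContinuousLinearMap
    { toFun := psi lam α
      map_add' := fun u v => by ext i; simp [mul_add]
      map_smul' := fun a u => by ext i; simp; ring }

@[simp]
theorem psiCLM_apply (α : ℝ) (θ : Params m) : psiCLM lam α θ = psi lam α θ :=
  rfl

/-- The vector `Λ θ`. -/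
noncomputable def lamMul (θ : Params m) : Params m :=
  WithLp.toLp 2 fun i => lam i * θ i

@[simp]
theorem lamMul_apply (θ : Params m) (i : Fin m) : lamMul lam θ i = lam i * θ i :=
  rfl

theorem continuous_lamMul : Continuous (lamMul lam : Params m → Params m) := by
  refine (PiLp.continuous_toLp 2 _).comp (continuous_pi fun i => ?_)
  fun_prop

variable {lam}

theorem hasDerivAt_psi_zero (θ : Params m) :
    HasDerivAt (fun α : ℝ => psi lam α θ) (lamMul lam θ) 0 := by
  have h : HasDerivAt (fun α : ℝ => fun i => Real.exp (α * lam i) * θ i)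
      (fun i => lam i * θ i) 0 := by
    refine hasDerivAt_pi.2 fun i => ?_
    simpa using (((hasDerivAt_id (0 : ℝ)).mul_const (lam i)).exp).mul_const (θ i)
  exact (PiLp.continuousLinearEquiv 2 ℝ fun _ : Fin m => ℝ).symm.hasFDerivAt.comp_hasDerivAt 0 h

theorem QuasiHomogeneous.hasGradientAt {F : Params m → ℝ} (hF : QuasiHomogeneous lam F) {α : ℝ}
    {u : Params m} (hd : DifferentiableAt ℝ F (psi lam α u)) :
    HasGradientAt F (Real.exp (-α) • psi lam α (gradient F (psi lam α u))) u := by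
  have h1 : F = fun w => Real.exp (-α) * F (psiCLM lam α w) := by
    ext w
    rw [psiCLM_apply, hF α w, ← mul_assoc, ← Real.exp_add, neg_add_cancel, Real.exp_zero, one_mul]
  have h2 : HasFDerivAt (fun w => F (psiCLM lam α w))
      ((fderiv ℝ F (psi lam α u)).comp (psiCLM lam α)) u :=
    HasFDerivAt.comp u (g := F) hd.hasFDerivAt (psiCLM lam α).hasFDerivAt
  have h3 := h2.const_mul (Real.exp (-α))
  rw [← h1] at h3
  rw [hasGradientAt_iff_hasFDerivAt]
  refine h3.congr_fderiv ?_
  ext w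
  simp [inner_psi_left, gradient]

/-- `∂°F(ψ_α u) = e^α ψ_{-α} ∂°F(u)` for a quasi-homogeneous function `F`. -/
theorem QuasiHomogeneous.smul_psi_mem_clarkeSubdifferential {F : Params m → ℝ}
    (hF : QuasiHomogeneous lam F) {α : ℝ} {u g : Params m}
    (hg : g ∈ clarkeSubdifferential F (psi lam α u)) :
    Real.exp (-α) • psi lam α g ∈ clarkeSubdifferential F u := by
  -- The map g ↦ e^{-α} ψ_α g is linear, so it is enough to treat limits of gradients; these are
  -- moved by shifting the sequence with ψ_{-α}.
  have hconv : Convex ℝ ((Real.exp (-α) • psiCLM lam α : Params m →L[ℝ] Params m) ⁻¹'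
      clarkeSubdifferential F u) :=
    (convex_clarkeSubdifferential F u).linear_preimage
      (Real.exp (-α) • psiCLM lam α : Params m →L[ℝ] Params m).toLinearMap
  refine convexHull_min ?_ hconv hg
  rintro g ⟨w, hd, hw, hgw⟩
  have hw' : ∀ k, psi lam α (psi lam (-α) (w k)) = w k := fun k => psi_psi_neg lam α _
  have hgrad : ∀ k, HasGradientAt F (Real.exp (-α) • psi lam α (gradient F (w k)))
      (psi lam (-α) (w k)) := by
    intro k
    have := hF.hasGradientAt (α := α) (u := psi lam (-α) (w k)) (by rw [hw']; exact hd k)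
    rwa [hw'] at this
  refine limitingGradients_subset F u ⟨fun k => psi lam (-α) (w k),
    fun k => (hgrad k).differentiableAt, ?_, ?_⟩
  · have := ((psiCLM lam (-α)).continuous.tendsto _).comp hw
    rw [psiCLM_apply, psi_neg_psi] at this
    exact this
  · simp only [(hgrad _).gradient]
    exact ((Real.exp (-α) • psiCLM lam α : Params m →L[ℝ] Params m).continuous.tendsto g).comp hgw

/-- Euler's identity for quasi-homogeneous functions. -/
theorem QuasiHomogeneous.inner_lamMul_eq {F : Params m → ℝ} (hF : QuasiHomogeneous lam F)
    (hcont : Continuous F) {u g : Params m} (hg : g ∈ clarkeSubdifferential F u) :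
    inner ℝ (lamMul lam u) g = F u := by
  have hgrad : ∀ w, DifferentiableAt ℝ F w → inner ℝ (lamMul lam w) (gradient F w) = F w := by
    intro w hd
    have hd0 : HasFDerivAt F (fderiv ℝ F w) (psi lam 0 w) := by
      rw [psi_zero]
      exact hd.hasFDerivAt
    have h1 := hd0.comp_hasDerivAt (0 : ℝ) (hasDerivAt_psi_zero (lam := lam) w)
    have h2 : HasDerivAt (fun α : ℝ => Real.exp α * F w) (F w) 0 := by
      simpa using (Real.hasDerivAt_exp 0).mul_const (F w)
    have h3 : F ∘ (fun α : ℝ => psi lam α w) = fun α => Real.exp α * F w := funext fun α => hF α w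
    rw [h3] at h1
    rw [real_inner_comm, ← h1.unique h2]
    simp [gradient]
  refine le_antisymm ?_ ?_
  · have := le_inner_of_mem_clarkeSubdifferential (x := u) (v := fun w => -lamMul lam w)
      (c := fun w => -F w) (continuous_lamMul lam).neg.continuousAt hcont.neg.continuousAt
      (Eventually.of_forall fun w hd => by rw [inner_neg_left, hgrad w hd]) hg
    rw [inner_neg_left] at this
    linarith
  · exact le_inner_of_mem_clarkeSubdifferential (x := u) (continuous_lamMul lam).continuousAt
      hcont.continuousAt (Eventually.of_forall fun w hd => (hgrad w hd).ge) hg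

end QuasiHomogeneity

/-! ### The loss as a smooth function of the score gaps -/

section GapLoss

variable {n C : ℕ}

/-- The cross-entropy loss as a function of the score gaps. -/
noncomputable def gapLoss (s : Fin n × Fin C → ℝ) : ℝ :=
  (n : ℝ)⁻¹ * ∑ j, Real.log (∑ c, Real.exp (-s (j, c)))

/-- The weight of a pair `(j, c)`: minus the partial derivative of `gapLoss` in the gap. -/
noncomputable def gapWeight (p : Fin n × Fin C) (s : Fin n × Fin C → ℝ) : ℝ :=
  (n : ℝ)⁻¹ * (Real.exp (-s p) / ∑ c, Real.exp (-s (p.1, c)))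

theorem sum_exp_gap_pos (j : Fin n) (c : Fin C) (s : Fin n × Fin C → ℝ) :
    0 < ∑ c, Real.exp (-s (j, c)) :=
  Finset.sum_pos (fun _ _ => Real.exp_pos _) ⟨c, Finset.mem_univ c⟩

theorem gapWeight_pos (p : Fin n × Fin C) (s : Fin n × Fin C → ℝ) : 0 < gapWeight p s := by
  have hn : (0 : ℝ) < n := Nat.cast_pos.2 p.1.pos
  have := sum_exp_gap_pos p.1 p.2 s
  unfold gapWeight
  positivity

theorem continuous_gapWeight (p : Fin n × Fin C) : Continuous (gapWeight p) := by
  unfold gapWeight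
  refine continuous_const.mul (Continuous.div (by fun_prop) (by fun_prop) fun s => ?_)
  exact (sum_exp_gap_pos p.1 p.2 s).ne'

theorem contDiff_gapLoss (hC : 0 < C) : ContDiff ℝ 1 (gapLoss : (Fin n × Fin C → ℝ) → ℝ) := by
  unfold gapLoss
  refine contDiff_const.mul (ContDiff.sum fun j _ => ContDiff.log (by fun_prop) fun s => ?_)
  exact (sum_exp_gap_pos j ⟨0, hC⟩ s).ne'

theorem hasFDerivAt_gapLoss (s : Fin n × Fin C → ℝ) :
    HasFDerivAt gapLoss (∑ p, (-gapWeight p s) •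
      (ContinuousLinearMap.proj p : (Fin n × Fin C → ℝ) →L[ℝ] ℝ)) s := by
  rcases Nat.eq_zero_or_pos C with rfl | hC
  · unfold gapLoss
    simpa using hasFDerivAt_const (𝕜 := ℝ) (0 : ℝ) s
  have hexp : ∀ p : Fin n × Fin C, HasFDerivAt (fun s : Fin n × Fin C → ℝ => Real.exp (-s p))
      (Real.exp (-s p) • -(ContinuousLinearMap.proj p : (Fin n × Fin C → ℝ) →L[ℝ] ℝ)) s :=
    fun p => (ContinuousLinearMap.proj (R := ℝ) (φ := fun _ : Fin n × Fin C => ℝ)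
      p).hasFDerivAt.neg.exp
  have h := (HasFDerivAt.fun_sum (u := Finset.univ) fun j _ =>
    ((HasFDerivAt.fun_sum (u := Finset.univ) fun c _ => hexp (j, c)).log
      (sum_exp_gap_pos j ⟨0, hC⟩ s).ne')).const_mul ((n : ℝ)⁻¹)
  refine h.congr_fderiv ?_
  ext w
  simp only [smul_apply, sum_apply, smul_eq_mul, neg_apply, ContinuousLinearMap.proj_apply, gapWeight,
    Fintype.sum_prod_type, Finset.mul_sum]
  refine Finset.sum_congr rfl fun j _ => Finset.sum_congr rfl fun c _ => ?_
  ring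

theorem hasDerivAt_gapLoss_comp {s : ℝ → Fin n × Fin C → ℝ} {d : Fin n × Fin C → ℝ} {t : ℝ}
    (h : ∀ p, HasDerivAt (fun r => s r p) (d p) t) :
    HasDerivAt (fun r => gapLoss (s r)) (∑ p, -gapWeight p (s t) * d p) t := by
  have := (hasFDerivAt_gapLoss (s t)).comp_hasDerivAt t (hasDerivAt_pi.2 h)
  simpa [Function.comp_def] using this

theorem gradient_gapLoss_comp {m : ℕ} {S : Fin n × Fin C → Params m → ℝ} {u : Params m}
    (h : ∀ p, DifferentiableAt ℝ (S p) u) :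
    gradient (fun w => gapLoss fun p => S p w) u =
      ∑ p, (-gapWeight p fun q => S q u) • gradient (S p) u := by
  have h1 := (hasFDerivAt_gapLoss fun p => S p u).comp u
    (hasFDerivAt_pi.2 fun p => (h p).hasFDerivAt)
  have h2 : HasGradientAt (fun w => gapLoss fun p => S p w)
      (∑ p, (-gapWeight p fun q => S q u) • gradient (S p) u) u := by
    rw [hasGradientAt_iff_hasFDerivAt]
    refine h1.congr_fderiv ?_
    ext w
    simp [gradient]
  exact h2.gradient

theorem crossEntropyLoss_eq_gapLoss {X : Type*} {m : ℕ} (f : X → Params m → Fin C → ℝ)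
    (x : Fin n → X) (y : Fin n → Fin C) (θ : Params m) :
    crossEntropyLoss f x y θ = gapLoss fun p => scoreGap f x y p.1 p.2 θ := by
  unfold crossEntropyLoss gapLoss
  rw [← mul_neg, ← Finset.sum_neg_distrib]
  congr 1
  refine Finset.sum_congr rfl fun j _ => ?_
  rw [← Real.log_inv, inv_div, Finset.sum_div]
  congr 1
  refine Finset.sum_congr rfl fun c _ => ?_
  rw [← Real.exp_sub]
  congr 1
  simp [scoreGap]

end GapLoss

theorem locallyLipschitz_pi {X ι : Type*} [PseudoMetricSpace X] [Fintype ι] {F : ι → X → ℝ}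
    (h : ∀ k, LocallyLipschitz (F k)) : LocallyLipschitz fun x k => F k x := by
  intro x
  choose K s hs hK using fun k => h k x
  refine ⟨Finset.univ.sup K, ⋂ k, s k, Filter.iInter_mem.2 hs, fun u hu w hw => ?_⟩
  refine edist_pi_le_iff.2 fun k => ?_
  refine (hK k (Set.mem_iInter.1 hu k) (Set.mem_iInter.1 hw k)).trans ?_
  gcongr
  exact_mod_cast Finset.le_sup (f := K) (Finset.mem_univ k)

/-! ### The smoothed margin and its comparison with the gaps -/

section GapMargin

variable {n C : ℕ}

/-- The smoothed margin `-log (exp (n L) - 1)`, as a function of the loss value `L`. -/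
noncomputable def smoothMargin (n : ℕ) (L : ℝ) : ℝ :=
  -Real.log (Real.exp (n * L) - 1)

variable {s : Fin n × Fin C → ℝ} {y : Fin n → Fin C}

theorem natCast_mul_gapLoss (s : Fin n × Fin C → ℝ) :
    n * gapLoss s = ∑ j, Real.log (∑ c, Real.exp (-s (j, c))) := by
  rcases Nat.eq_zero_or_pos n with rfl | hn
  · simp
  · have : (n : ℝ) ≠ 0 := by positivity
    rw [gapLoss, mul_inv_cancel_left₀ this]

theorem one_add_exp_neg_le_sum (hs : ∀ j, s (j, y j) = 0) {j : Fin n} {c : Fin C} (hc : c ≠ y j) :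
    1 + Real.exp (-s (j, c)) ≤ ∑ c, Real.exp (-s (j, c)) := by
  have h := Finset.sum_le_sum_of_subset_of_nonneg (Finset.subset_univ {y j, c})
    (f := fun c => Real.exp (-s (j, c))) fun i _ _ => (Real.exp_pos _).le
  rw [Finset.sum_pair hc.symm, hs j] at h
  simpa using h

theorem one_le_sum_exp (hs : ∀ j, s (j, y j) = 0) (j : Fin n) :
    1 ≤ ∑ c, Real.exp (-s (j, c)) := by
  have h := Finset.single_le_sum (f := fun c => Real.exp (-s (j, c)))
    (fun i _ => (Real.exp_pos _).le) (Finset.mem_univ (y j))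
  simpa [hs j] using h

/-- e^{nL} is the product over j of Z_j = ∑_c e^{-s_{jc}}. All factors are at least 1, so it
dominates each Z_j, and Z_j contains 1 (from c = y_j) and e^{-s_{jc}}. -/
theorem exp_neg_gap_le (hs : ∀ j, s (j, y j) = 0) {j : Fin n} {c : Fin C} (hc : c ≠ y j) :
    Real.exp (-s (j, c)) ≤ Real.exp (n * gapLoss s) - 1 := by
  have h1 := one_add_exp_neg_le_sum hs hc
  have h2 : Real.log (∑ c, Real.exp (-s (j, c))) ≤ n * gapLoss s := by
    rw [natCast_mul_gapLoss]
    exact Finset.single_le_sum (f := fun j => Real.log (∑ c, Real.exp (-s (j, c))))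
      (fun i _ => Real.log_nonneg (one_le_sum_exp hs i)) (Finset.mem_univ j)
  have h3 := Real.exp_le_exp.2 h2
  rw [Real.exp_log (by linarith [one_le_sum_exp hs j])] at h3
  linarith

theorem exp_mul_gapLoss_sub_one_pos (hn : 0 < n) (hC : 2 ≤ C) (hs : ∀ j, s (j, y j) = 0) :
    0 < Real.exp (n * gapLoss s) - 1 := by
  have : Nontrivial (Fin C) := Fin.nontrivial_iff_two_le.2 hC
  obtain ⟨c, hc⟩ := exists_ne (y ⟨0, hn⟩)
  exact (Real.exp_pos _).trans_le (exp_neg_gap_le hs hc)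

theorem smoothMargin_le_gap (hs : ∀ j, s (j, y j) = 0) {j : Fin n} {c : Fin C} (hc : c ≠ y j) :
    smoothMargin n (gapLoss s) ≤ s (j, c) := by
  have h := Real.log_le_log (Real.exp_pos _) (exp_neg_gap_le hs hc)
  rw [Real.log_exp] at h
  unfold smoothMargin
  linarith

/-- The loss threshold n⁻¹ log 2 is exactly what makes e^{nL} - 1 < 1. -/
theorem smoothMargin_pos (hn : 0 < n) (hC : 2 ≤ C) (hs : ∀ j, s (j, y j) = 0)
    (hlog : gapLoss s < (n : ℝ)⁻¹ * Real.log 2) : 0 < smoothMargin n (gapLoss s) := by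
  have hn' : (0 : ℝ) < n := Nat.cast_pos.2 hn
  have h1 : n * gapLoss s < Real.log 2 := by
    have := mul_lt_mul_of_pos_left hlog hn'
    rwa [mul_inv_cancel_left₀ hn'.ne'] at this
  have h2 := Real.exp_lt_exp.2 h1
  rw [Real.exp_log two_pos] at h2
  have h3 := Real.log_neg (exp_mul_gapLoss_sub_one_pos hn hC hs) (by linarith)
  unfold smoothMargin
  linarith

/-- A union bound for independent events of probability 1 - 1/Z_i. -/
theorem one_sub_prod_inv_le {ι : Type*} (I : Finset ι) {Z : ι → ℝ} (hZ : ∀ i, 1 ≤ Z i) :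
    1 - ∏ i ∈ I, (Z i)⁻¹ ≤ ∑ i ∈ I, (1 - (Z i)⁻¹) := by
  classical
  induction I using Finset.induction_on with
  | empty => simp
  | insert a I ha ih =>
    rw [Finset.prod_insert ha, Finset.sum_insert ha]
    have h1 : ∏ i ∈ I, (Z i)⁻¹ ≤ 1 :=
      Finset.prod_le_one (fun i _ => inv_nonneg.2 (zero_le_one.trans (hZ i)))
        fun i _ => inv_le_one_of_one_le₀ (hZ i)
    have h2 := inv_le_one_of_one_le₀ (hZ a)
    nlinarith

/-- By the union bound, 1 - e^{-nL} ≤ ∑ (1 - 1/Z_j). The j-th term is n times the total weight of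
the wrong classes of j, whose gaps are all at least G. The left side is the denominator in the
logarithmic derivative of G along the flow. -/
theorem smoothMargin_mul_le (hs : ∀ j, s (j, y j) = 0) (hpos : 0 ≤ smoothMargin n (gapLoss s)) :
    (1 - Real.exp (-(n * gapLoss s))) * smoothMargin n (gapLoss s) ≤
      n * ∑ p, gapWeight p s * s p := by
  set G := smoothMargin n (gapLoss s) with hG
  set Z : Fin n → ℝ := fun j => ∑ c, Real.exp (-s (j, c)) with hZ
  have hZ1 : ∀ j, 1 ≤ Z j := one_le_sum_exp hs
  have hexp : Real.exp (-(n * gapLoss s)) = ∏ j, (Z j)⁻¹ := by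
    rw [natCast_mul_gapLoss, ← Finset.sum_neg_distrib, Real.exp_sum]
    refine Finset.prod_congr rfl fun j _ => ?_
    rw [Real.exp_neg, Real.exp_log (by linarith [hZ1 j])]
  have hj : ∀ j, (1 - (Z j)⁻¹) * G ≤ ∑ c, n * (gapWeight (j, c) s * s (j, c)) := by
    intro j
    have hn : (n : ℝ) ≠ 0 := Nat.cast_ne_zero.2 j.pos.ne'
    have hZj : 0 < Z j := by linarith [hZ1 j]
    have h1 : (1 - (Z j)⁻¹) * G = ∑ c, (Real.exp (-s (j, c)) / Z j * G -
        if c = y j then (Z j)⁻¹ * G else 0) := by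
      rw [Finset.sum_sub_distrib, Finset.sum_ite_eq' Finset.univ (y j), ← Finset.sum_mul,
        ← Finset.sum_div]
      rw [if_pos (Finset.mem_univ _)]
      change _ = Z j / Z j * G - _
      rw [div_self hZj.ne']
      ring
    rw [h1]
    refine Finset.sum_le_sum fun c _ => ?_
    have h2 : n * (gapWeight (j, c) s * s (j, c)) = Real.exp (-s (j, c)) / Z j * s (j, c) := by
      change n * ((n : ℝ)⁻¹ * (Real.exp (-s (j, c)) / Z j) * s (j, c)) = _
      rw [mul_assoc, mul_inv_cancel_left₀ hn]
    rw [h2]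
    split_ifs with hc
    · subst hc
      simp [hs j]
    · rw [sub_zero]
      exact mul_le_mul_of_nonneg_left (smoothMargin_le_gap hs hc) (by positivity)
  calc (1 - Real.exp (-(n * gapLoss s))) * G ≤ (∑ j, (1 - (Z j)⁻¹)) * G := by
        rw [hexp]
        exact mul_le_mul_of_nonneg_right (one_sub_prod_inv_le Finset.univ hZ1) hpos
    _ ≤ ∑ j, ∑ c, n * (gapWeight (j, c) s * s (j, c)) := by
        rw [Finset.sum_mul]
        exact Finset.sum_le_sum fun j _ => hj j
    _ = n * ∑ p, gapWeight p s * s p := by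
        rw [Finset.mul_sum, Fintype.sum_prod_type]

end GapMargin

/-! ### The `Λ`-seminorm and the logarithmic scale -/

section LamNorms

variable {m : ℕ} {lam : Fin m → ℝ}

/-- The squared `Λ`-seminorm. -/
noncomputable def lamSq (lam : Fin m → ℝ) (θ : Params m) : ℝ :=
  ∑ i, lam i * θ i ^ 2

theorem lamSq_nonneg (hlam : ∀ i, 0 ≤ lam i) (θ : Params m) : 0 ≤ lamSq lam θ :=
  Finset.sum_nonneg fun i _ => mul_nonneg (hlam i) (sq_nonneg _)

theorem contDiff_lamSq : ContDiff ℝ 1 (lamSq lam) := by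
  unfold lamSq
  fun_prop

theorem le_lamMax (i : Fin m) : lam i ≤ lamMax lam :=
  le_ciSup (Set.finite_range lam).bddAbove i

theorem lamMax_pos (hlam : ∀ i, 0 ≤ lam i) (hne : lam ≠ 0) : 0 < lamMax lam := by
  obtain ⟨i, hi⟩ := Function.ne_iff.1 hne
  exact (lt_of_le_of_ne (hlam i) (Ne.symm hi)).trans_le (le_lamMax i)

theorem norm_lamMul_sq_le (hlam : ∀ i, 0 ≤ lam i) (θ : Params m) :
    ‖lamMul lam θ‖ ^ 2 ≤ lamMax lam * lamSq lam θ := by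
  rw [EuclideanSpace.norm_sq_eq, lamSq, Finset.mul_sum]
  refine Finset.sum_le_sum fun i _ => ?_
  rw [lamMul_apply, Real.norm_eq_abs, sq_abs, mul_pow, sq (lam i), mul_assoc]
  exact mul_le_mul_of_nonneg_right (le_lamMax i) (mul_nonneg (hlam i) (sq_nonneg _))

theorem hasDerivAt_apply {z : ℝ → Params m} {v : Params m} {t : ℝ} (hz : HasDerivAt z v t)
    (i : Fin m) : HasDerivAt (fun r => z r i) (v i) t :=
  (EuclideanSpace.proj (𝕜 := ℝ) i).hasFDerivAt.comp_hasDerivAt t hz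

theorem hasDerivAt_lamSq_comp {z : ℝ → Params m} {v : Params m} {t : ℝ} (hz : HasDerivAt z v t) :
    HasDerivAt (fun r => lamSq lam (z r)) (2 * inner ℝ (lamMul lam (z t)) v) t := by
  have h := HasDerivAt.fun_sum (u := Finset.univ) fun i _ =>
    ((hasDerivAt_apply hz i).pow 2).const_mul (lam i)
  refine h.congr_deriv ?_
  simp only [PiLp.inner_apply, lamMul_apply, RCLike.inner_apply, conj_trivial, Finset.mul_sum]
  refine Finset.sum_congr rfl fun i _ => ?_
  norm_num
  ring

theorem lamSq_eq_zero_iff (hlam : ∀ i, 0 ≤ lam i) {θ : Params m} :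
    lamSq lam θ = 0 ↔ ∀ i, lam i = 0 ∨ θ i = 0 := by
  rw [lamSq, Finset.sum_eq_zero_iff_of_nonneg fun i _ => mul_nonneg (hlam i) (sq_nonneg _)]
  simp

/-- A quasi-homogeneous function vanishes where the `Λ`-seminorm vanishes. -/
theorem QuasiHomogeneous.lamSq_pos {F : Params m → ℝ} (hF : QuasiHomogeneous lam F)
    (hlam : ∀ i, 0 ≤ lam i) {θ : Params m} (h : F θ ≠ 0) : 0 < lamSq lam θ := by
  refine lt_of_le_of_ne (lamSq_nonneg hlam θ) fun h0 => h ?_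
  -- A vector of zero seminorm is fixed by every ψ_α, which forces F θ = e · F θ.
  have hfix : psi lam 1 θ = θ := by
    ext i
    rcases (lamSq_eq_zero_iff hlam).1 h0.symm i with hi | hi <;> simp [hi]
  have h1 := hF 1 θ
  rw [hfix] at h1
  have h2 : 1 < Real.exp 1 := Real.one_lt_exp_iff.2 one_pos
  by_contra h3
  have : (Real.exp 1 - 1) * F θ = 0 := by linarith
  rcases mul_eq_zero.1 this with h4 | h4
  · linarith
  · exact h3 h4

/-- The logarithmic scale of a parameter vector, measured with the `Λ`-seminorm. -/
noncomputable def lamScale (lam : Fin m → ℝ) (θ : Params m) : ℝ :=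
  Real.log (lamSq lam θ) / (2 * lamMax lam)

theorem exp_lamScale_mul (hL : 0 < lamMax lam) {θ : Params m} (hθ : 0 < lamSq lam θ) :
    Real.exp (lamScale lam θ * lamMax lam) = Real.sqrt (lamSq lam θ) := by
  have h1 : lamScale lam θ * lamMax lam = Real.log (lamSq lam θ) / 2 := by
    unfold lamScale
    field_simp
  rw [h1, ← Real.log_sqrt hθ.le, Real.exp_log (Real.sqrt_pos.2 hθ)]

end LamNorms

/-! ### The flow: decreasing loss, growing seminorm, monotone normalized margin -/

section GapFlow

open Filter Topology MeasureTheory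

variable {m n C : ℕ}

/-- An arc that follows the negative Clarke subdifferential of a loss `gapLoss` of quasi-homogeneous
gap functions `S`. The flow is recorded through the almost everywhere valid consequences of the
chain rule. -/
structure GapFlow (lam : Fin m → ℝ) (S : Fin n × Fin C → Params m → ℝ) (y : Fin n → Fin C)
    (θ : ℝ → Params m) : Prop where
  n_pos : 0 < n
  two_le : 2 ≤ C
  lam_nonneg : ∀ i, 0 ≤ lam i
  lam_ne : lam ≠ 0
  quasi : ∀ p, QuasiHomogeneous lam (S p)
  lip : ∀ p, LocallyLipschitz (S p)
  gap_self : ∀ j u, S (j, y j) u = 0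
  isArc : IsArc θ
  ae_flow : ∀ᵐ t, 0 < t → ∃ v : Params m, HasDerivAt θ v t ∧
    HasDerivAt (fun r => gapLoss fun p => S p (θ r)) (-‖v‖ ^ 2) t ∧
    inner ℝ (lamMul lam (θ t)) v = ∑ p, gapWeight p (fun q => S q (θ t)) * S p (θ t) ∧
    ∀ (V : Params m) (b : Fin n × Fin C → ℝ),
      (∀ p, ∀ g ∈ clarkeSubdifferential (S p) (θ t),
        b p ≤ gapWeight p (fun q => S q (θ t)) * inner ℝ V g) → ∑ p, b p ≤ inner ℝ V v

theorem IsArc.absolutelyContinuousOnInterval {z : ℝ → Params m} (hz : IsArc z) {a b : ℝ}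
    (ha : 0 ≤ a) (hab : a ≤ b) : AbsolutelyContinuousOnInterval z a b := by
  refine (hz (b + 1) (by linarith)).mono ?_
  rw [Set.uIcc_of_le hab, Set.uIcc_of_le (by linarith)]
  exact Set.Icc_subset_Icc ha (by linarith)

theorem AbsolutelyContinuousOnInterval.comp_contDiffAt {E F : Type*} [NormedAddCommGroup E]
    [NormedSpace ℝ E] [NormedAddCommGroup F] [NormedSpace ℝ F] {φ : E → F} {z : ℝ → E} {a b : ℝ}
    (hz : AbsolutelyContinuousOnInterval z a b)
    (hφ : ∀ t ∈ Set.uIcc a b, ContDiffAt ℝ 1 φ (z t)) :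
    AbsolutelyContinuousOnInterval (fun t => φ (z t)) a b :=
  hz.comp_locallyLipschitz fun t ht => (hφ t ht).exists_lipschitzOnWith

namespace GapFlow

variable {lam : Fin m → ℝ} {S : Fin n × Fin C → Params m → ℝ} {y : Fin n → Fin C}
  {θ : ℝ → Params m}

theorem lamMax_pos (h : GapFlow lam S y θ) : 0 < lamMax lam :=
  _root_.lamMax_pos h.lam_nonneg h.lam_ne

theorem absolutelyContinuous_loss (h : GapFlow lam S y θ) {a b : ℝ} (ha : 0 ≤ a) (hab : a ≤ b) :
    AbsolutelyContinuousOnInterval (fun t => gapLoss fun p => S p (θ t)) a b := by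
  have h1 : AbsolutelyContinuousOnInterval (fun t p => S p (θ t)) a b :=
    (h.isArc.absolutelyContinuousOnInterval ha hab).comp_locallyLipschitz
      (F := fun u p => S p u) fun t _ => locallyLipschitz_pi h.lip (θ t)
  exact h1.comp_contDiffAt (φ := gapLoss) fun t _ =>
    (contDiff_gapLoss (by linarith [h.two_le] : 0 < C)).contDiffAt

theorem loss_antitone (h : GapFlow lam S y θ) {a b : ℝ} (ha : 0 ≤ a) (hab : a ≤ b) :
    (gapLoss fun p => S p (θ b)) ≤ gapLoss fun p => S p (θ a) := by
  have h1 := ((h.absolutelyContinuous_loss ha hab).neg).le_of_ae_hasDerivAt_nonneg hab ?_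
  · simpa using h1
  · filter_upwards [h.ae_flow] with t ht htab
    obtain ⟨v, -, hv, -⟩ := ht (ha.trans_lt htab.1)
    exact ⟨_, hv.neg, by rw [neg_neg]; positivity⟩

theorem smoothMargin_pos (h : GapFlow lam S y θ) {t₀ t : ℝ} (ht₀ : 0 ≤ t₀)
    (hsep : (gapLoss fun p => S p (θ t₀)) < (n : ℝ)⁻¹ * Real.log 2) (ht : t₀ ≤ t) :
    0 < smoothMargin n (gapLoss fun p => S p (θ t)) :=
  _root_.smoothMargin_pos h.n_pos h.two_le (fun j => h.gap_self j (θ t))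
    ((h.loss_antitone ht₀ ht).trans_lt hsep)

theorem gap_pos (h : GapFlow lam S y θ) {t₀ t : ℝ} (ht₀ : 0 ≤ t₀)
    (hsep : (gapLoss fun p => S p (θ t₀)) < (n : ℝ)⁻¹ * Real.log 2) (ht : t₀ ≤ t)
    {j : Fin n} {c : Fin C} (hc : c ≠ y j) : 0 < S (j, c) (θ t) :=
  (h.smoothMargin_pos ht₀ hsep ht).trans_le
    (smoothMargin_le_gap (s := fun p => S p (θ t)) (fun j => h.gap_self j (θ t)) hc)

theorem lamSq_pos (h : GapFlow lam S y θ) {t₀ t : ℝ} (ht₀ : 0 ≤ t₀)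
    (hsep : (gapLoss fun p => S p (θ t₀)) < (n : ℝ)⁻¹ * Real.log 2) (ht : t₀ ≤ t) :
    0 < lamSq lam (θ t) := by
  have : Nontrivial (Fin C) := Fin.nontrivial_iff_two_le.2 h.two_le
  obtain ⟨c, hc⟩ := exists_ne (y ⟨0, h.n_pos⟩)
  exact (h.quasi (⟨0, h.n_pos⟩, c)).lamSq_pos h.lam_nonneg (h.gap_pos ht₀ hsep ht hc).ne'

theorem weighted_gap_pos (h : GapFlow lam S y θ) {t₀ t : ℝ} (ht₀ : 0 ≤ t₀)
    (hsep : (gapLoss fun p => S p (θ t₀)) < (n : ℝ)⁻¹ * Real.log 2) (ht : t₀ ≤ t) :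
    0 < ∑ p, gapWeight p (fun q => S q (θ t)) * S p (θ t) := by
  have : Nontrivial (Fin C) := Fin.nontrivial_iff_two_le.2 h.two_le
  obtain ⟨c, hc⟩ := exists_ne (y ⟨0, h.n_pos⟩)
  refine Finset.sum_pos' (fun p _ => ?_) ⟨(⟨0, h.n_pos⟩, c), Finset.mem_univ _, ?_⟩
  · by_cases hp : p.2 = y p.1
    · have : S p (θ t) = 0 := by
        have := h.gap_self p.1 (θ t)
        rwa [← hp] at this
      rw [this, mul_zero]
    · exact mul_nonneg (gapWeight_pos _ _).le (h.gap_pos ht₀ hsep ht hp).le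
  · exact mul_pos (gapWeight_pos _ _) (h.gap_pos ht₀ hsep ht hc)

/-- The derivative of ‖θ‖_Λ² is 2⟨Λθ, v⟩, twice the weighted gap sum. Taking `δ` = 0 gives
monotonicity; a positive `δ` will force divergence. -/
theorem lamSq_sub_ge (h : GapFlow lam S y θ) {a b δ : ℝ} (ha : 0 ≤ a) (hab : a ≤ b)
    (hδ : ∀ t, a ≤ t → δ ≤ ∑ p, gapWeight p (fun q => S q (θ t)) * S p (θ t)) :
    2 * δ * (b - a) ≤ lamSq lam (θ b) - lamSq lam (θ a) := by
  refine ((h.isArc.absolutelyContinuousOnInterval ha hab).comp_contDiffAt fun t _ =>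
    contDiff_lamSq.contDiffAt).mul_sub_le_of_ae_hasDerivAt hab ?_
  filter_upwards [h.ae_flow] with t ht htab
  obtain ⟨v, hv, -, hQ, -⟩ := ht (ha.trans_lt htab.1)
  refine ⟨_, hasDerivAt_lamSq_comp hv, ?_⟩
  rw [hQ]
  linarith [hδ t htab.1.le]

theorem lamSq_mono (h : GapFlow lam S y θ) {t₀ a b : ℝ} (ht₀ : 0 ≤ t₀)
    (hsep : (gapLoss fun p => S p (θ t₀)) < (n : ℝ)⁻¹ * Real.log 2) (ha : t₀ ≤ a) (hab : a ≤ b) :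
    lamSq lam (θ a) ≤ lamSq lam (θ b) := by
  have := h.lamSq_sub_ge (δ := 0) (ht₀.trans ha) hab fun t ht =>
    (h.weighted_gap_pos ht₀ hsep (ha.trans ht)).le
  linarith

theorem hasDerivAt_log_smoothMargin {n : ℕ} {L : ℝ → ℝ} {d t : ℝ} (hL : HasDerivAt L d t)
    (h1 : 0 < Real.exp (n * L t) - 1) (h2 : 0 < smoothMargin n (L t)) :
    HasDerivAt (fun r => Real.log (smoothMargin n (L r)))
      (-(n * d) / ((1 - Real.exp (-(n * L t))) * smoothMargin n (L t))) t := by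
  have h3 := ((((hL.const_mul (n : ℝ)).exp.sub_const 1).log h1.ne').neg).log h2.ne'
  refine h3.congr_deriv ?_
  have h4 : (1 - Real.exp (-(n * L t))) * Real.exp (n * L t) = Real.exp (n * L t) - 1 := by
    rw [sub_mul, ← Real.exp_add]
    simp
  have h5 : 1 - Real.exp (-(n * L t)) ≠ 0 := by
    intro h0
    rw [h0, zero_mul] at h4
    linarith
  change -(Real.exp (n * L t) * (n * d) / (Real.exp (n * L t) - 1)) / smoothMargin n (L t) = _
  rw [← h4]
  have := Real.exp_pos (n * L t)
  field_simp

/-- The smoothed margin, normalized by the appropriate power of the `Λ`-seminorm, is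
nondecreasing. -/
theorem exists_mul_exp_lamScale_le (h : GapFlow lam S y θ) {t₀ : ℝ} (ht₀ : 0 ≤ t₀)
    (hsep : (gapLoss fun p => S p (θ t₀)) < (n : ℝ)⁻¹ * Real.log 2) :
    ∃ c : ℝ, 0 < c ∧ ∀ t, t₀ ≤ t → c * Real.exp (lamScale lam (θ t)) ≤
      smoothMargin n (gapLoss fun p => S p (θ t)) := by
  have hM := h.lamMax_pos
  have hE : ∀ t, 0 < Real.exp (n * gapLoss fun p => S p (θ t)) - 1 := fun t =>
    exp_mul_gapLoss_sub_one_pos h.n_pos h.two_le fun j => h.gap_self j (θ t)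
  have hG : ∀ t, t₀ ≤ t → 0 < smoothMargin n (gapLoss fun p => S p (θ t)) := fun t ht =>
    h.smoothMargin_pos ht₀ hsep ht
  -- log G - σ is nondecreasing: with D = (1 - e^{-nL}) G and N = ‖θ‖_Λ², its derivative is n‖v‖²/D
  -- - Q/(λ_max N).
  have hmono : ∀ t, t₀ ≤ t →
      Real.log (smoothMargin n (gapLoss fun p => S p (θ t₀))) - lamScale lam (θ t₀) ≤
      Real.log (smoothMargin n (gapLoss fun p => S p (θ t))) - lamScale lam (θ t) := by
    intro T hT
    have hac1 : AbsolutelyContinuousOnInterval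
        (fun t => Real.log (smoothMargin n (gapLoss fun p => S p (θ t)))) t₀ T := by
      refine (h.absolutelyContinuous_loss ht₀ hT).comp_contDiffAt
        (φ := fun L => Real.log (smoothMargin n L)) fun t ht => ?_
      rw [Set.uIcc_of_le hT] at ht
      refine ContDiffAt.log (ContDiffAt.neg (ContDiffAt.log ?_ (hE t).ne')) (hG t ht.1).ne'
      fun_prop
    have hac2 : AbsolutelyContinuousOnInterval (fun t => lamScale lam (θ t)) t₀ T := by
      refine (h.isArc.absolutelyContinuousOnInterval ht₀ hT).comp_contDiffAt fun t ht => ?_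
      rw [Set.uIcc_of_le hT] at ht
      exact (contDiff_lamSq.contDiffAt.log (h.lamSq_pos ht₀ hsep ht.1).ne').div_const _
    refine (hac1.sub hac2).le_of_ae_hasDerivAt_nonneg hT ?_
    filter_upwards [h.ae_flow] with t ht htT
    obtain ⟨v, hv, hL, hQ, -⟩ := ht (ht₀.trans_lt htT.1)
    have hN := h.lamSq_pos ht₀ hsep htT.1.le
    refine ⟨_, (hasDerivAt_log_smoothMargin hL (hE t) (hG t htT.1.le)).sub
      (((hasDerivAt_lamSq_comp hv).log hN.ne').div_const (2 * lamMax lam)), ?_⟩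
    have hQpos := h.weighted_gap_pos ht₀ hsep htT.1.le
    have hkey := smoothMargin_mul_le (s := fun p => S p (θ t)) (fun j => h.gap_self j (θ t))
      (hG t htT.1.le).le
    rw [← hQ] at hQpos hkey
    set Q := inner ℝ (lamMul lam (θ t)) v with hQdef
    set D := (1 - Real.exp (-(n * gapLoss fun p => S p (θ t)))) *
      smoothMargin n (gapLoss fun p => S p (θ t)) with hD
    have hn : (0 : ℝ) < n := Nat.cast_pos.2 h.n_pos
    have hDpos : 0 < D := by
      refine mul_pos ?_ (hG t htT.1.le)
      have h4 : (0 : ℝ) < n * gapLoss fun p => S p (θ t) := by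
        have := hE t
        rw [sub_pos, Real.one_lt_exp_iff] at this
        exact this
      have h5 : Real.exp (-(n * gapLoss fun p => S p (θ t))) < 1 := by
        rw [Real.exp_lt_one_iff]
        linarith
      linarith
    have hCS : Q ^ 2 ≤ lamMax lam * lamSq lam (θ t) * ‖v‖ ^ 2 := by
      have h6 := abs_real_inner_le_norm (lamMul lam (θ t)) v
      have h7 := pow_le_pow_left₀ (abs_nonneg _) h6 2
      rw [sq_abs, mul_pow] at h7
      exact h7.trans (mul_le_mul_of_nonneg_right (norm_lamMul_sq_le h.lam_nonneg _) (sq_nonneg _))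
    have e1 : -((n : ℝ) * -‖v‖ ^ 2) / D = n * ‖v‖ ^ 2 / D := by ring
    have e2 : 2 * Q / lamSq lam (θ t) / (2 * lamMax lam) =
        Q / (lamMax lam * lamSq lam (θ t)) := by
      field_simp
    rw [e1, e2, sub_nonneg, div_le_div_iff₀ (by positivity) hDpos]
    -- D ≤ nQ and Q > 0; then Cauchy–Schwarz bounds Q² by λ_max N ‖v‖².
    have h8 : Q * D ≤ n * Q ^ 2 := by nlinarith
    nlinarith
  refine ⟨Real.exp (Real.log (smoothMargin n (gapLoss fun p => S p (θ t₀))) - lamScale lam (θ t₀)),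
    Real.exp_pos _, fun t ht => ?_⟩
  rw [← Real.exp_add, ← Real.exp_log (hG t ht), Real.exp_le_exp]
  linarith [hmono t ht]

end GapFlow

end GapFlow

/-! ### Divergence of the seminorm and convergence of the rescaled parameters -/

section ScaleConvergence

open Filter Topology MeasureTheory

variable {m n C : ℕ} {lam : Fin m → ℝ}

open Classical in
theorem tendsto_exp_mul_sub_lamMax {ι : Type*} {l : Filter ι} {τ : ι → ℝ}
    (hτ : Tendsto τ l atTop) (i : Fin m) :
    Tendsto (fun t => Real.exp (τ t * (lam i - lamMax lam))) l
      (𝓝 (if lam i = lamMax lam then 1 else 0)) := by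
  split_ifs with h
  · simpa [h] using tendsto_const_nhds
  · have hlt : lam i - lamMax lam < 0 := sub_neg.2 (lt_of_le_of_ne (le_lamMax i) h)
    exact Real.tendsto_exp_atBot.comp (hτ.atTop_mul_const_of_neg hlt)

theorem lamNormalize_eq_psi (hlam : ∀ i, 0 ≤ lam i) {θ : Params m} (hθ : 0 < lamSq lam θ) :
    ∃ τ : ℝ, lamNormalize lam θ = psi lam (-τ) θ := by
  have h := (existsUnique_normalization lam hlam θ (Real.sqrt_pos.2 hθ)).exists
  exact ⟨h.choose, by rw [lamNormalize, dif_pos h]⟩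

open Classical in
theorem lamMaxSeminorm_sq (hlam : ∀ i, 0 ≤ lam i) (θ : Params m) :
    lamMaxSeminorm lam θ ^ 2 =
      ∑ i, lam i * ((if lam i = lamMax lam then 1 else 0) ^ 2 * θ i ^ 2) := by
  rw [lamMaxSeminorm, Real.sq_sqrt (Finset.sum_nonneg fun i _ => mul_nonneg (hlam i) (sq_nonneg _)),
    Finset.sum_filter]
  refine Finset.sum_congr rfl fun i _ => ?_
  split_ifs <;> simp

theorem lamSq_psi_mono (hlam : ∀ i, 0 ≤ lam i) {α β : ℝ} (hαβ : α ≤ β) (θ : Params m) :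
    lamSq lam (psi lam α θ) ≤ lamSq lam (psi lam β θ) := by
  refine Finset.sum_le_sum fun i _ => mul_le_mul_of_nonneg_left ?_ (hlam i)
  rw [psi_apply, psi_apply, mul_pow, mul_pow]
  have := mul_le_mul_of_nonneg_right hαβ (hlam i)
  gcongr

theorem norm_psi_le (hlam : ∀ i, 0 ≤ lam i) {α : ℝ} (hα : α ≤ 0) (θ : Params m) :
    ‖psi lam α θ‖ ≤ ‖θ‖ := by
  rw [EuclideanSpace.norm_eq, EuclideanSpace.norm_eq]
  refine Real.sqrt_le_sqrt (Finset.sum_le_sum fun i _ => ?_)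
  rw [psi_apply, norm_mul, Real.norm_of_nonneg (Real.exp_pos _).le]
  have h1 : Real.exp (α * lam i) ≤ 1 :=
    Real.exp_le_one_iff.2 (mul_nonpos_of_nonpos_of_nonneg hα (hlam i))
  exact pow_le_pow_left₀ (by positivity) (mul_le_of_le_one_left (norm_nonneg _) h1) 2

theorem lamSq_psi_div (τ : ℝ) (θ : Params m) :
    lamSq lam (psi lam τ θ) / Real.exp (τ * lamMax lam) ^ 2 =
      ∑ i, lam i * (Real.exp (τ * (lam i - lamMax lam)) ^ 2 * θ i ^ 2) := by
  rw [lamSq, Finset.sum_div]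
  refine Finset.sum_congr rfl fun i _ => ?_
  rw [psi_apply, mul_sub, Real.exp_sub]
  ring

theorem lamMaxSeminorm_sq_mul_le (hlam : ∀ i, 0 ≤ lam i) (τ : ℝ) (θ : Params m) :
    lamMaxSeminorm lam θ ^ 2 * Real.exp (τ * lamMax lam) ^ 2 ≤ lamSq lam (psi lam τ θ) := by
  classical
  rw [← le_div_iff₀ (by positivity), lamSq_psi_div, lamMaxSeminorm_sq hlam]
  refine Finset.sum_le_sum fun i _ => mul_le_mul_of_nonneg_left ?_ (hlam i)
  refine mul_le_mul_of_nonneg_right ?_ (sq_nonneg _)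
  split_ifs with h
  · simp [h]
  · rw [zero_pow two_ne_zero]
    positivity

theorem continuous_lamMaxSeminorm : Continuous (lamMaxSeminorm lam) := by
  unfold lamMaxSeminorm
  fun_prop

namespace GapFlow

variable {S : Fin n × Fin C → Params m → ℝ} {y : Fin n → Fin C} {θ : ℝ → Params m}

/-- If the nondecreasing ‖θ‖_Λ stayed bounded, so would the scale τ in θ = ψ_τ(θ̂), from above, and
θ would eventually lie in a ball, including the coordinates with λ_i = 0, since θ̂ converges. There
the weights are bounded below by compactness and the gaps by margin monotonicity, so ‖θ‖_Λ² would
grow linearly. -/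
theorem tendsto_lamSq_atTop (h : GapFlow lam S y θ) {t₀ : ℝ} (ht₀ : 0 ≤ t₀)
    (hsep : (gapLoss fun p => S p (θ t₀)) < (n : ℝ)⁻¹ * Real.log 2) {θlim : Params m}
    (hconv : Tendsto (fun t => lamNormalize lam (θ t)) atTop (𝓝 θlim)) {κ : ℝ} (hκ : 0 < κ)
    (hcond : ∀ t, t₀ ≤ t → κ ≤ lamMaxSeminorm lam (lamNormalize lam (θ t))) :
    Tendsto (fun t => lamSq lam (θ t)) atTop atTop := by
  have hM := h.lamMax_pos
  suffices hunb : ∀ B : ℝ, ∃ t, t₀ ≤ t ∧ B ≤ lamSq lam (θ t) by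
    refine tendsto_atTop.2 fun B => ?_
    obtain ⟨t, ht, hB⟩ := hunb B
    filter_upwards [eventually_ge_atTop t] with r hr
    exact hB.trans (h.lamSq_mono ht₀ hsep ht hr)
  intro B
  by_contra! hcon
  have hτ : ∀ t, t₀ ≤ t → ∃ τ, lamNormalize lam (θ t) = psi lam (-τ) (θ t) := fun t ht =>
    lamNormalize_eq_psi h.lam_nonneg (h.lamSq_pos ht₀ hsep ht)
  -- `T` solves κ² e^{2 T λ_max} = B: the top coordinates alone force τ ≤ `T`.
  set T : ℝ := Real.log (B / κ ^ 2) / (2 * lamMax lam) with hT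
  have hB : 0 < B := (h.lamSq_pos ht₀ hsep le_rfl).trans (hcon t₀ le_rfl)
  have hτT : ∀ t, t₀ ≤ t → ∃ τ ≤ T, θ t = psi lam τ (lamNormalize lam (θ t)) := by
    intro t ht
    obtain ⟨τ, hτ⟩ := hτ t ht
    have hθ : θ t = psi lam τ (lamNormalize lam (θ t)) := by rw [hτ, psi_psi_neg]
    refine ⟨τ, ?_, hθ⟩
    have h1 := lamMaxSeminorm_sq_mul_le h.lam_nonneg τ (lamNormalize lam (θ t))
    rw [← hθ] at h1
    have h2 : κ ^ 2 * Real.exp (τ * lamMax lam) ^ 2 ≤ B :=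
      (mul_le_mul_of_nonneg_right (pow_le_pow_left₀ hκ.le (hcond t ht) 2) (sq_nonneg _)).trans
        (h1.trans (hcon t ht).le)
    have h3 : Real.exp (2 * lamMax lam * τ) ≤ B / κ ^ 2 := by
      rw [le_div_iff₀ (by positivity), mul_comm (Real.exp _)]
      refine le_of_eq_of_le ?_ h2
      rw [← Real.exp_nat_mul]
      congr 2
      push_cast
      ring
    have h4 := (Real.le_log_iff_exp_le (by positivity)).2 h3
    rw [hT, le_div_iff₀ (by positivity)]
    linarith
  have hbdd : ∀ᶠ t in atTop, ‖θ t‖ ≤ ‖psi lam T θlim‖ + 1 := by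
    have h1 : Tendsto (fun t => ‖psi lam T (lamNormalize lam (θ t))‖) atTop
        (𝓝 ‖psi lam T θlim‖) :=
      (((psiCLM lam T).continuous.tendsto θlim).comp hconv).norm
    filter_upwards [h1.eventually (gt_mem_nhds (lt_add_one _)), eventually_ge_atTop t₀] with t h2 ht
    obtain ⟨τ, hτ, hθ⟩ := hτT t ht
    -- τ has no lower bound here, but ψ with a nonpositive parameter contracts the norm.
    have h3 : θ t = psi lam (τ - T) (psi lam T (lamNormalize lam (θ t))) := by
      rw [psi_psi, sub_add_cancel]
      exact hθ
    rw [h3]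
    exact (norm_psi_le h.lam_nonneg (sub_nonpos.2 hτ) _).trans h2.le
  have : Nontrivial (Fin C) := Fin.nontrivial_iff_two_le.2 h.two_le
  obtain ⟨c, hc⟩ := exists_ne (y ⟨0, h.n_pos⟩)
  set p : Fin n × Fin C := (⟨0, h.n_pos⟩, c) with hp
  have hcont : Continuous fun u => gapWeight p fun q => S q u :=
    (continuous_gapWeight p).comp (continuous_pi fun q => (h.lip q).continuous)
  obtain ⟨u, -, hu⟩ := (isCompact_closedBall (0 : Params m) (‖psi lam T θlim‖ + 1)).exists_isMinOn
    ⟨0, Metric.mem_closedBall_self (by positivity)⟩ hcont.continuousOn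
  set ω := gapWeight p fun q => S q u with hω
  have hω0 : 0 < ω := gapWeight_pos _ _
  obtain ⟨k, hk, hkG⟩ := h.exists_mul_exp_lamScale_le ht₀ hsep
  set γ := k * Real.exp (lamScale lam (θ t₀)) with hγ
  have hγ0 : 0 < γ := by positivity
  obtain ⟨t₁, ht₁⟩ := eventually_atTop.1 (hbdd.and (eventually_ge_atTop t₀))
  have ht₁₀ : t₀ ≤ t₁ := (ht₁ t₁ le_rfl).2
  have hδ : ∀ t, t₁ ≤ t → ω * γ ≤ ∑ p, gapWeight p (fun q => S q (θ t)) * S p (θ t) := by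
    intro t ht
    obtain ⟨hbd, htt₀⟩ := ht₁ t ht
    have h1 : ω ≤ gapWeight p fun q => S q (θ t) :=
      isMinOn_iff.1 hu _ (by simpa using hbd)
    have h2 : γ ≤ S p (θ t) := by
      have h3 : lamScale lam (θ t₀) ≤ lamScale lam (θ t) := by
        unfold lamScale
        have := Real.log_le_log (h.lamSq_pos ht₀ hsep le_rfl) (h.lamSq_mono ht₀ hsep le_rfl htt₀)
        gcongr
      calc γ ≤ k * Real.exp (lamScale lam (θ t)) := by
            rw [hγ]
            gcongr
        _ ≤ _ := hkG t htt₀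
        _ ≤ S p (θ t) := smoothMargin_le_gap (s := fun p => S p (θ t))
            (fun j => h.gap_self j (θ t)) hc
    refine (mul_le_mul h1 h2 hγ0.le (gapWeight_pos _ _).le).trans ?_
    refine Finset.single_le_sum (f := fun p => gapWeight p (fun q => S q (θ t)) * S p (θ t))
      (fun q _ => mul_nonneg (gapWeight_pos _ _).le ?_) (Finset.mem_univ p)
    by_cases hq : q.2 = y q.1
    · have := h.gap_self q.1 (θ t)
      rw [← hq] at this
      exact this.ge
    · exact (h.gap_pos ht₀ hsep htt₀ hq).le
  have hpos : 0 < 2 * (ω * γ) := by positivity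
  have hgrow := h.lamSq_sub_ge (ht₀.trans ht₁₀)
    (le_add_of_nonneg_right (div_nonneg hB.le hpos.le) : t₁ ≤ t₁ + B / (2 * (ω * γ))) hδ
  have h5 : 2 * (ω * γ) * (t₁ + B / (2 * (ω * γ)) - t₁) = B := by
    rw [add_sub_cancel_left, mul_div_cancel₀ _ hpos.ne']
  rw [h5] at hgrow
  have h6 := hcon (t₁ + B / (2 * (ω * γ))) (ht₁₀.trans
    (le_add_of_nonneg_right (div_nonneg hB.le hpos.le)))
  have h7 := h.lamSq_pos ht₀ hsep ht₁₀
  linarith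

/-- The parameters rescaled by the `Λ`-seminorm converge, to a rescaling of the limit of the
normalized parameters. -/
theorem exists_tendsto_psi_neg_lamScale (h : GapFlow lam S y θ) {t₀ : ℝ} (ht₀ : 0 ≤ t₀)
    (hsep : (gapLoss fun p => S p (θ t₀)) < (n : ℝ)⁻¹ * Real.log 2) {θlim : Params m}
    (hconv : Tendsto (fun t => lamNormalize lam (θ t)) atTop (𝓝 θlim)) {κ : ℝ} (hκ : 0 < κ)
    (hcond : ∀ t, t₀ ≤ t → κ ≤ lamMaxSeminorm lam (lamNormalize lam (θ t))) :
    ∃ δ : ℝ, Tendsto (fun t => psi lam (-lamScale lam (θ t)) (θ t)) atTop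
      (𝓝 (psi lam δ θlim)) := by
  classical
  have hM := h.lamMax_pos
  have hN := h.tendsto_lamSq_atTop ht₀ hsep hconv hκ hcond
  have hτex : ∀ t, t₀ ≤ t → ∃ τ, θ t = psi lam τ (lamNormalize lam (θ t)) := fun t ht => by
    obtain ⟨τ, hτ⟩ := lamNormalize_eq_psi h.lam_nonneg (h.lamSq_pos ht₀ hsep ht)
    exact ⟨τ, by rw [hτ, psi_psi_neg]⟩
  choose! τ hτ using hτex
  -- While τ < T, ‖θ‖_Λ² is at most the seminorm squared of ψ_T(θ̂), which converges; divergence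
  -- rules this out eventually.
  have hτtop : Tendsto τ atTop atTop := by
    refine tendsto_atTop.2 fun T => ?_
    have h1 : Tendsto (fun t => lamSq lam (psi lam T (lamNormalize lam (θ t)))) atTop
        (𝓝 (lamSq lam (psi lam T θlim))) :=
      ((contDiff_lamSq.continuous.comp (psiCLM lam T).continuous).tendsto θlim).comp hconv
    filter_upwards [h1.eventually (gt_mem_nhds (lt_add_one _)), eventually_ge_atTop t₀,
      hN.eventually_ge_atTop (lamSq lam (psi lam T θlim) + 1)] with t h2 ht h3
    by_contra! hlt
    have h4 := lamSq_psi_mono h.lam_nonneg hlt.le (lamNormalize lam (θ t))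
    rw [← hτ t ht] at h4
    linarith
  have hcoord : ∀ i, Tendsto (fun t => lamNormalize lam (θ t) i) atTop (𝓝 (θlim i)) := fun i =>
    ((EuclideanSpace.proj (𝕜 := ℝ) i).continuous.tendsto θlim).comp hconv
  -- Only top coordinates survive this normalization. Since the limit is positive, its logarithm
  -- gives a finite limit of σ - τ.
  have hratio : Tendsto (fun t => lamSq lam (θ t) / Real.exp (τ t * lamMax lam) ^ 2) atTop
      (𝓝 (lamMaxSeminorm lam θlim ^ 2)) := by
    rw [lamMaxSeminorm_sq h.lam_nonneg]
    have h1 := tendsto_finsetSum (Finset.univ : Finset (Fin m)) fun i _ =>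
      (((tendsto_exp_mul_sub_lamMax (lam := lam) hτtop i).pow 2).mul
        ((hcoord i).pow 2)).const_mul (lam i)
    refine h1.congr' ?_
    filter_upwards [eventually_ge_atTop t₀] with t ht
    rw [← lamSq_psi_div, ← hτ t ht]
  have hpos : 0 < lamMaxSeminorm lam θlim ^ 2 := by
    have h1 : κ ≤ lamMaxSeminorm lam θlim :=
      ge_of_tendsto ((continuous_lamMaxSeminorm.tendsto θlim).comp hconv)
        ((eventually_ge_atTop t₀).mono fun t ht => hcond t ht)
    have := hκ.trans_le h1
    positivity
  have hlog := (hratio.log hpos.ne').div_const (2 * lamMax lam)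
  set δ := Real.log (lamMaxSeminorm lam θlim ^ 2) / (2 * lamMax lam) with hδ
  refine ⟨-δ, ?_⟩
  have hdiff : Tendsto (fun t => -lamScale lam (θ t) + τ t) atTop (𝓝 (-δ)) := by
    refine hlog.neg.congr' ?_
    filter_upwards [eventually_ge_atTop t₀] with t ht
    rw [Real.log_div (h.lamSq_pos ht₀ hsep ht).ne' (by positivity), Real.log_pow, Real.log_exp,
      lamScale]
    push_cast
    field_simp
    ring
  have h2 := ((continuous_psi lam).tendsto (-δ, θlim)).comp (hdiff.prodMk_nhds hconv)
  refine h2.congr' ?_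
  filter_upwards [eventually_ge_atTop t₀] with t ht
  change psi lam (-lamScale lam (θ t) + τ t) (lamNormalize lam (θ t)) = _
  rw [← psi_psi, ← hτ t ht]

end GapFlow

end ScaleConvergence

/-! ### Concentration on active gaps and the test function for the direction -/

section LimitDirection

open Filter Topology MeasureTheory

variable {m n C : ℕ} {lam : Fin m → ℝ}

theorem inner_eq_zero_of_mem_clarkeSubdifferential {F : Params m → ℝ} (hF : ∀ u, F u = 0)
    {u g v : Params m} (hg : g ∈ clarkeSubdifferential F u) : inner ℝ v g = 0 := by
  have hgrad : ∀ w, gradient F w = 0 := fun w => by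
    rw [show F = fun _ => (0 : ℝ) from funext hF]
    simp
  have key : ∀ v : Params m, 0 ≤ inner ℝ v g := fun v =>
    le_inner_of_mem_clarkeSubdifferential (v := fun _ => v) (c := fun _ => 0) continuousAt_const
      continuousAt_const (Eventually.of_forall fun w _ => by rw [hgrad, inner_zero_right]) hg
  have h1 := key (-v)
  rw [inner_neg_left] at h1
  linarith [key v]

/-- For nonnegative gaps the partition sums lie between 1 and C, so weights compare like e^{-s} up
to the factor C. -/
theorem gapWeight_le_mul {s : Fin n × Fin C → ℝ} {y : Fin n → Fin C} (hs : ∀ j, s (j, y j) = 0)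
    (hnonneg : ∀ p, 0 ≤ s p) (p q : Fin n × Fin C) :
    gapWeight p s ≤ C * Real.exp (s q - s p) * gapWeight q s := by
  have hZp := one_le_sum_exp hs p.1
  have hZq : ∑ c, Real.exp (-s (q.1, c)) ≤ C := by
    have : ∑ c, Real.exp (-s (q.1, c)) ≤ ∑ _c : Fin C, (1 : ℝ) :=
      Finset.sum_le_sum fun c _ => Real.exp_le_one_iff.2 (neg_nonpos.2 (hnonneg _))
    simpa using this
  have hZq0 := sum_exp_gap_pos q.1 q.2 s
  have hn : (0 : ℝ) ≤ (n : ℝ)⁻¹ := by positivity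
  have h1 : gapWeight p s ≤ (n : ℝ)⁻¹ * Real.exp (-s p) :=
    mul_le_mul_of_nonneg_left (div_le_self (Real.exp_pos _).le hZp) hn
  have h2 : 1 ≤ C / ∑ c, Real.exp (-s (q.1, c)) := (one_le_div hZq0).2 hZq
  calc gapWeight p s ≤ (n : ℝ)⁻¹ * Real.exp (-s p) := h1
    _ ≤ (n : ℝ)⁻¹ * Real.exp (-s p) * (C / ∑ c, Real.exp (-s (q.1, c))) :=
        le_mul_of_one_le_right (by positivity) h2
    _ = C * Real.exp (s q - s p) * gapWeight q s := by
        have h3 : Real.exp (-s p) = Real.exp (s q - s p) * Real.exp (-s q) := by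
          rw [← Real.exp_add]
          congr 1
          ring
        rw [h3, gapWeight]
        ring

open Classical in
/-- The projection to the coordinates of largest weight. -/
noncomputable def topProj (lam : Fin m → ℝ) (u : Params m) : Params m :=
  WithLp.toLp 2 fun i => if lam i = lamMax lam then u i else 0

open Classical in
@[simp]
theorem topProj_apply (u : Params m) (i : Fin m) :
    topProj lam u i = if lam i = lamMax lam then u i else 0 :=
  rfl

theorem tendsto_sum_exp_mul {ι : Type*} {l : Filter ι} {σ : ι → ℝ} {u : ι → Params m}
    {ubar : Params m} (hσ : Tendsto σ l atTop) (hu : Tendsto u l (𝓝 ubar)) (a : Fin m → ℝ) :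
    Tendsto (fun t => ∑ i, a i * (Real.exp (σ t * (lam i - lamMax lam)) ^ 2 * u t i)) l
      (𝓝 (∑ i, a i * topProj lam ubar i)) := by
  classical
  refine tendsto_finsetSum _ fun i _ => ?_
  have h1 := (((tendsto_exp_mul_sub_lamMax (lam := lam) hσ i).pow 2).mul
    (((EuclideanSpace.proj (𝕜 := ℝ) i).continuous.tendsto ubar).comp hu)).const_mul (a i)
  refine (h1.congr fun t => rfl).trans (le_of_eq ?_)
  congr 1
  rw [topProj_apply]
  split_ifs <;> simp

/-- The function `⟪v, e^{-σ λ_max} ψ_σ θ⟫ - e ‖θ‖_Λ`, with `σ = lamScale θ`, whose monotonicity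
along the flow determines the limit direction. -/
noncomputable def directionGap (lam : Fin m → ℝ) (v : Params m) (e : ℝ) (θ : Params m) : ℝ :=
  ∑ i, v i * (Real.exp (lamScale lam θ * (lam i - lamMax lam)) * θ i) -
    e * Real.exp (lamScale lam θ * lamMax lam)

theorem contDiffAt_lamScale {θ : Params m} (hθ : 0 < lamSq lam θ) :
    ContDiffAt ℝ 1 (lamScale lam) θ :=
  (contDiff_lamSq.contDiffAt.log hθ.ne').div_const _

theorem contDiffAt_directionGap {θ : Params m} (hθ : 0 < lamSq lam θ) (v : Params m) (e : ℝ) :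
    ContDiffAt ℝ 1 (directionGap lam v e) θ := by
  have h := contDiffAt_lamScale hθ
  unfold directionGap
  refine ContDiffAt.sub (ContDiffAt.sum fun i _ => ?_) ?_
  · exact contDiffAt_const.mul ((h.mul contDiffAt_const).exp.mul (by fun_prop))
  · exact contDiffAt_const.mul (h.mul contDiffAt_const).exp

theorem hasDerivAt_lamScale_comp {z : ℝ → Params m} {v : Params m} {t : ℝ}
    (hz : HasDerivAt z v t) (hpos : 0 < lamSq lam (z t)) :
    HasDerivAt (fun r => lamScale lam (z r))
      (inner ℝ (lamMul lam (z t)) v / (lamMax lam * lamSq lam (z t))) t := by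
  refine (((hasDerivAt_lamSq_comp hz).log hpos.ne').div_const (2 * lamMax lam)).congr_deriv ?_
  rw [div_div, ← mul_assoc, mul_comm (lamSq lam (z t)) 2, mul_assoc,
    mul_div_mul_left _ _ two_ne_zero, mul_comm (lamSq lam (z t))]

/-- The first term pairs the velocity with ψ_σ v, which undoes the scaling ψ_{-σ} of subgradients.
The sum, caused by the motion of σ, carries λ_i - λ_max on coordinate i and disappears in the limit.
-/
theorem hasDerivAt_directionGap_comp {z : ℝ → Params m} {w : Params m} {t : ℝ}
    (hz : HasDerivAt z w t) (hM : 0 < lamMax lam) (hpos : 0 < lamSq lam (z t)) (v : Params m)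
    (e : ℝ) :
    HasDerivAt (fun r => directionGap lam v e (z r))
      (inner ℝ (Real.exp (-(lamScale lam (z t) * lamMax lam)) • psi lam (lamScale lam (z t)) v) w +
        inner ℝ (lamMul lam (z t)) w * Real.exp (-(lamScale lam (z t) * lamMax lam)) *
        (∑ i, v i * ((lam i - lamMax lam) / lamMax lam) *
          (Real.exp (lamScale lam (z t) * (lam i - lamMax lam)) ^ 2 *
            psi lam (-lamScale lam (z t)) (z t) i) - e)) t := by
  have hσ := hasDerivAt_lamScale_comp hz hpos
  have h1 := (HasDerivAt.fun_sum (u := Finset.univ) fun i _ =>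
    (((hσ.mul_const (lam i - lamMax lam)).exp.mul (hasDerivAt_apply hz i)).const_mul (v i))).sub
      ((hσ.mul_const (lamMax lam)).exp.const_mul e)
  refine h1.congr_deriv ?_
  have hN : lamSq lam (z t) = Real.exp (lamScale lam (z t) * lamMax lam) ^ 2 := by
    rw [exp_lamScale_mul hM hpos, Real.sq_sqrt hpos.le]
  rw [hN]
  set σ := lamScale lam (z t) with hσdef
  set Q := inner ℝ (lamMul lam (z t)) w with hQ
  have hE : Real.exp (-(σ * lamMax lam)) = (Real.exp (σ * lamMax lam))⁻¹ := Real.exp_neg _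
  have hEpos := Real.exp_pos (σ * lamMax lam)
  have hi : ∀ i, Real.exp (σ * (lam i - lamMax lam)) =
      Real.exp (σ * lam i) * (Real.exp (σ * lamMax lam))⁻¹ := fun i => by
    rw [mul_sub, Real.exp_sub, div_eq_mul_inv]
  rw [inner_smul_left, PiLp.inner_apply, mul_sub, Finset.mul_sum, Finset.mul_sum, ← add_sub_assoc,
    ← Finset.sum_add_distrib]
  congr 1
  · refine Finset.sum_congr rfl fun i _ => ?_
    simp only [psi_apply, RCLike.inner_apply, conj_trivial, hi, hE]
    rw [neg_mul, Real.exp_neg]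
    have := Real.exp_pos (σ * lam i)
    field_simp
    ring
  · rw [hE]
    field_simp

/-- Since θ_i = e^{σ λ_i} u_i, coordinate i carries the factor e^{2σ(λ_i - λ_max)}, so only the top
part of u remains as σ → ∞. -/
theorem directionGap_div {θ : Params m} (v : Params m) (e : ℝ) :
    directionGap lam v e θ / Real.exp (lamScale lam θ * lamMax lam) =
      ∑ i, v i * (Real.exp (lamScale lam θ * (lam i - lamMax lam)) ^ 2 *
        psi lam (-lamScale lam θ) θ i) - e := by
  have hEpos := Real.exp_pos (lamScale lam θ * lamMax lam)
  rw [directionGap, sub_div, mul_div_cancel_right₀ _ hEpos.ne', Finset.sum_div]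
  congr 1
  refine Finset.sum_congr rfl fun i _ => ?_
  rw [psi_apply, neg_mul, Real.exp_neg, mul_sub, Real.exp_sub]
  have := Real.exp_pos (lamScale lam θ * lam i)
  field_simp

namespace GapFlow

variable {S : Fin n × Fin C → Params m → ℝ} {y : Fin n → Fin C} {θ : ℝ → Params m}

/-- Along the flow, the weighted gap sum is dominated by the constraints that are active in the
limit. -/
theorem eventually_weighted_sum_nonneg (h : GapFlow lam S y θ) {t₀ : ℝ} (ht₀ : 0 ≤ t₀)
    (hsep : (gapLoss fun p => S p (θ t₀)) < (n : ℝ)⁻¹ * Real.log 2)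
    (hσ : Tendsto (fun t => lamScale lam (θ t)) atTop atTop) {ubar : Params m}
    (hu : Tendsto (fun t => psi lam (-lamScale lam (θ t)) (θ t)) atTop (𝓝 ubar))
    {p₀ : Fin n × Fin C} (hp₀ : p₀.2 ≠ y p₀.1)
    (hmin : ∀ p : Fin n × Fin C, p.2 ≠ y p.1 → S p₀ ubar ≤ S p ubar)
    {β : Fin n × Fin C → ℝ} {e : ℝ} (hβself : ∀ j, β (j, y j) = 0)
    (hβ : ∀ p : Fin n × Fin C, p.2 ≠ y p.1 → S p ubar = S p₀ ubar → e * S p₀ ubar < β p) :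
    ∀ᶠ t in atTop, e * ∑ p, gapWeight p (fun q => S q (θ t)) *
        S p (psi lam (-lamScale lam (θ t)) (θ t)) ≤
      ∑ p, gapWeight p (fun q => S q (θ t)) * β p := by
  set U : ℝ → Params m := fun t => psi lam (-lamScale lam (θ t)) (θ t) with hU
  set w : Fin n × Fin C → ℝ → ℝ := fun p t => gapWeight p fun q => S q (θ t) with hw
  have hw0 : ∀ p t, 0 < w p t := fun p t => gapWeight_pos _ _
  have hlim : ∀ p, Tendsto (fun t => β p - e * S p (U t)) atTop (𝓝 (β p - e * S p ubar)) :=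
    fun p => tendsto_const_nhds.sub
      ((((h.lip p).continuous.tendsto ubar).comp hu).const_mul e)
  set K : ℝ := ((Fintype.card (Fin n × Fin C) : ℕ) : ℝ) with hK
  have hK0 : 0 < K := by
    have : Nonempty (Fin n × Fin C) := ⟨p₀⟩
    exact Nat.cast_pos.2 Fintype.card_pos
  set η : ℝ := (β p₀ - e * S p₀ ubar) / 2 with hη
  have hη0 : 0 < η := half_pos (sub_pos.2 (hβ p₀ hp₀ rfl))
  -- The reference pair `p₀` contributes at least η w_{p₀}, half its limiting slack. Each of the K
  -- pairs may lose η w_{p₀}/K, so the lower bounds sum to exactly 0.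
  have key : ∀ p, ∀ᶠ t in atTop,
      w p₀ t * η * ((if p = p₀ then 1 else 0) - K⁻¹) ≤ w p t * (β p - e * S p (U t)) := by
    intro p
    by_cases hpp : p = p₀
    · subst hpp
      filter_upwards [(hlim p).eventually (lt_mem_nhds (by linarith :
        (β p - e * S p ubar) / 2 < β p - e * S p ubar))] with t ht
      rw [if_pos rfl, mul_assoc]
      refine mul_le_mul_of_nonneg_left ?_ (hw0 p t).le
      have : η * (1 - K⁻¹) ≤ η := mul_le_of_le_one_right hη0.le (by
        have := inv_pos.2 hK0
        linarith)
      linarith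
    have hneg : ∀ t, w p₀ t * η * ((if p = p₀ then 1 else 0) - K⁻¹) = -(w p₀ t * η * K⁻¹) := by
      intro t
      rw [if_neg hpp]
      ring
    simp only [hneg]
    have hnegpos : ∀ t, -(w p₀ t * η * K⁻¹) ≤ 0 := fun t => by
      have := hw0 p₀ t
      have : 0 < w p₀ t * η * K⁻¹ := by positivity
      linarith
    by_cases hself : p.2 = y p.1
    · refine Eventually.of_forall fun t => ?_
      have h1 := hβself p.1
      have h2 := h.gap_self p.1 (U t)
      rw [← hself] at h1 h2
      rw [show β p = 0 from h1, show S p (U t) = 0 from h2]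
      simpa using hnegpos t
    by_cases hact : S p ubar = S p₀ ubar
    · have h1 : 0 < β p - e * S p ubar := by
        rw [hact]
        exact sub_pos.2 (hβ p hself hact)
      filter_upwards [(hlim p).eventually (lt_mem_nhds h1)] with t ht
      exact (hnegpos t).trans (mul_nonneg (hw0 p t).le ht.le)
    · have hlt : S p₀ ubar < S p ubar := lt_of_le_of_ne (hmin p hself) (Ne.symm hact)
      set M : ℝ := |β p - e * S p ubar| + 1 with hM
      have hM0 : 0 < M := by positivity
      have hMlt : -M < β p - e * S p ubar := by
        have := neg_abs_le (β p - e * S p ubar)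
        linarith
      -- The gap difference is e^σ times one with a negative limit, so the weight of the inactive
      -- `p` is negligible against that of `p₀`.
      have hgap : Tendsto (fun t => S p₀ (θ t) - S p (θ t)) atTop atBot := by
        have h1 : Tendsto (fun t => S p₀ (U t) - S p (U t)) atTop
            (𝓝 (S p₀ ubar - S p ubar)) :=
          (((h.lip p₀).continuous.tendsto ubar).comp hu).sub
            (((h.lip p).continuous.tendsto ubar).comp hu)
        have h2 := (Real.tendsto_exp_atTop.comp hσ).atTop_mul_neg (sub_neg.2 hlt) h1
        refine h2.congr fun t => ?_
        change Real.exp (lamScale lam (θ t)) * (S p₀ (U t) - S p (U t)) = _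
        rw [mul_sub, ← h.quasi p₀, ← h.quasi p, hU, psi_psi_neg]
      have hsmall : Tendsto (fun t => C * Real.exp (S p₀ (θ t) - S p (θ t)) * M) atTop
          (𝓝 (C * 0 * M)) :=
        ((Real.tendsto_exp_atBot.comp hgap).const_mul (C : ℝ)).mul_const M
      rw [mul_zero, zero_mul] at hsmall
      filter_upwards [(hlim p).eventually (lt_mem_nhds hMlt), eventually_ge_atTop t₀,
        hsmall.eventually (gt_mem_nhds (by positivity : 0 < η * K⁻¹))] with t h1 h2 h3
      have hnn : ∀ q, 0 ≤ S q (θ t) := fun q => by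
        by_cases hq : q.2 = y q.1
        · have := h.gap_self q.1 (θ t)
          rw [← hq] at this
          exact this.ge
        · exact (h.gap_pos ht₀ hsep h2 hq).le
      have h4 := gapWeight_le_mul (s := fun q => S q (θ t)) (fun j => h.gap_self j (θ t)) hnn p p₀
      have h5 : w p t * M ≤ w p₀ t * η * K⁻¹ :=
        calc w p t * M ≤ C * Real.exp (S p₀ (θ t) - S p (θ t)) * w p₀ t * M :=
              mul_le_mul_of_nonneg_right h4 hM0.le
          _ = w p₀ t * (C * Real.exp (S p₀ (θ t) - S p (θ t)) * M) := by ring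
          _ ≤ w p₀ t * (η * K⁻¹) := mul_le_mul_of_nonneg_left h3.le (hw0 p₀ t).le
          _ = w p₀ t * η * K⁻¹ := by ring
      have h6 : w p t * -M ≤ w p t * (β p - e * S p (U t)) :=
        mul_le_mul_of_nonneg_left h1.le (hw0 p t).le
      linarith
  filter_upwards [eventually_all.2 key] with t ht
  have hsum := Finset.sum_le_sum fun p (_ : p ∈ Finset.univ) => ht p
  have hzero : ∑ p, w p₀ t * η * ((if p = p₀ then 1 else 0) - K⁻¹) = 0 := by
    rw [← Finset.mul_sum, Finset.sum_sub_distrib, Finset.sum_ite_eq' Finset.univ p₀]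
    simp only [Finset.mem_univ, if_true, Finset.sum_const, Finset.card_univ, nsmul_eq_mul]
    rw [← hK, mul_inv_cancel₀ hK0.ne', sub_self, mul_zero]
  rw [hzero] at hsum
  simp only [mul_sub, Finset.sum_sub_distrib] at hsum
  rw [Finset.mul_sum]
  have hcomm : ∑ p, e * (w p t * S p (U t)) = ∑ p, w p t * (e * S p (U t)) :=
    Finset.sum_congr rfl fun p _ => by ring
  rw [hcomm]
  linarith

end GapFlow

end LimitDirection

/-! ### The limit direction lies in the active hull -/

section MaxMargin

open Filter Topology MeasureTheory

variable {m n C : ℕ} {lam : Fin m → ℝ}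

namespace GapFlow

variable {S : Fin n × Fin C → Params m → ℝ} {y : Fin n → Fin C} {θ : ℝ → Params m}

/-- Up to a positive factor, the top coordinates of the limit lie in the convex hull of the Clarke
subdifferentials of the active gaps. -/
theorem smul_topProj_mem_convexHull (h : GapFlow lam S y θ) {t₀ : ℝ} (ht₀ : 0 ≤ t₀)
    (hsep : (gapLoss fun p => S p (θ t₀)) < (n : ℝ)⁻¹ * Real.log 2)
    (hσ : Tendsto (fun t => lamScale lam (θ t)) atTop atTop) {ubar : Params m}
    (hu : Tendsto (fun t => psi lam (-lamScale lam (θ t)) (θ t)) atTop (𝓝 ubar))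
    {p₀ : Fin n × Fin C} (hp₀ : p₀.2 ≠ y p₀.1) (hpos : 0 < S p₀ ubar)
    (hmin : ∀ p : Fin n × Fin C, p.2 ≠ y p.1 → S p₀ ubar ≤ S p ubar) :
    S p₀ ubar • topProj lam ubar ∈ convexHull ℝ
      (⋃ p, ⋃ _ : p.2 ≠ y p.1 ∧ S p ubar = S p₀ ubar, clarkeSubdifferential (S p) ubar) := by
  classical
  by_contra hx
  have hM := h.lamMax_pos
  have hclosed : IsClosed (convexHull ℝ
      (⋃ p, ⋃ _ : p.2 ≠ y p.1 ∧ S p ubar = S p₀ ubar, clarkeSubdifferential (S p) ubar)) :=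
    (isCompact_iUnion fun p => isCompact_iUnion fun _ =>
      isCompact_clarkeSubdifferential (h.lip p) ubar).convexHull_of_finiteDimensional.isClosed
  obtain ⟨f, c, hfx, hfc⟩ := geometric_hahn_banach_point_closed (convex_convexHull ℝ _) hclosed hx
  set v : Params m := (InnerProductSpace.toDual ℝ (Params m)).symm f with hv
  have hfv : ∀ w, f w = inner ℝ v w := fun w => by simp [hv]
  rw [hfv, inner_smul_right] at hfx
  set q := S p₀ ubar with hq
  have hlt : inner ℝ v (topProj lam ubar) < c / q := by
    rw [lt_div_iff₀ hpos]
    linarith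
  -- Two levels are needed: `e₁` bounds the drift from below, `e₂` enters the test function, and e₁
  -- - e₂ absorbs the error from the motion of σ.
  obtain ⟨e₁, he₁, he₁c⟩ := exists_between hlt
  obtain ⟨e₂, he₂, he₂₁⟩ := exists_between he₁
  have hbelow : ∀ p, ∃ B : ℝ, ∀ g ∈ clarkeSubdifferential (S p) ubar, B < inner ℝ v g := by
    intro p
    obtain ⟨B, hB⟩ := ((isCompact_clarkeSubdifferential (h.lip p) ubar).image
      (by fun_prop : Continuous fun g : Params m => (inner ℝ v g : ℝ))).bddBelow
    refine ⟨B - 1, fun g hg => ?_⟩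
    have := hB ⟨g, hg, rfl⟩
    linarith
  choose B hB using hbelow
  -- Lower bounds for ⟨v, g⟩ valid near `ubar`: the separating constant on active pairs, a crude
  -- compactness bound on inactive ones.
  set β : Fin n × Fin C → ℝ := fun p =>
    if p.2 = y p.1 then 0 else if S p ubar = q then c else B p with hβ
  have hev1 : ∀ᶠ t in atTop, ∀ p, ∀ g ∈ clarkeSubdifferential (S p)
      (psi lam (-lamScale lam (θ t)) (θ t)), β p ≤ inner ℝ v g := by
    refine eventually_all.2 fun p => ?_
    by_cases hself : p.2 = y p.1
    · refine Eventually.of_forall fun t g hg => ?_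
      have h0 : ∀ u, S p u = 0 := fun u => by
        have := h.gap_self p.1 u
        rwa [← hself] at this
      rw [inner_eq_zero_of_mem_clarkeSubdifferential h0 hg]
      simp [hβ, hself]
    · refine hu.eventually (eventually_le_inner_clarkeSubdifferential (h.lip p) fun g hg => ?_)
      by_cases hact : S p ubar = q
      · simp only [hβ, if_neg hself, if_pos hact]
        rw [← hfv]
        refine hfc g (subset_convexHull ℝ _ ?_)
        simp only [Set.mem_iUnion]
        exact ⟨p, ⟨hself, hact⟩, hg⟩
      · simp only [hβ, if_neg hself, if_neg hact]
        exact hB p g hg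
  have hev2 := h.eventually_weighted_sum_nonneg ht₀ hsep hσ hu hp₀ hmin (β := β) (e := e₁)
    (fun j => by simp [hβ]) fun p hp hact => by
      have : β p = c := by simp only [hβ, if_neg hp, if_pos (hact.trans hq.symm)]
      rw [this]
      rwa [lt_div_iff₀ hpos] at he₁c
  -- The limit is 0: top coordinates have λ_i = λ_max, all others decay.
  have hev3 : ∀ᶠ t in atTop, e₂ - e₁ < ∑ i, v i * ((lam i - lamMax lam) / lamMax lam) *
      (Real.exp (lamScale lam (θ t) * (lam i - lamMax lam)) ^ 2 *
        psi lam (-lamScale lam (θ t)) (θ t) i) := by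
    have h1 := tendsto_sum_exp_mul (lam := lam) hσ hu
      fun i => v i * ((lam i - lamMax lam) / lamMax lam)
    refine h1.eventually (lt_mem_nhds ?_)
    rw [Finset.sum_eq_zero]
    · linarith
    · intro i _
      rw [topProj_apply]
      split_ifs with hi <;> simp [hi]
  obtain ⟨t₁, ht₁⟩ := eventually_atTop.1 (hev1.and (hev2.and (hev3.and (eventually_ge_atTop t₀))))
  have ht₁₀ : t₀ ≤ t₁ := (ht₁ t₁ le_rfl).2.2.2
  have hmono : ∀ T, t₁ ≤ T → directionGap lam v e₂ (θ t₁) ≤ directionGap lam v e₂ (θ T) := by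
    intro T hT
    refine ((h.isArc.absolutelyContinuousOnInterval (ht₀.trans ht₁₀) hT).comp_contDiffAt
      fun t ht => ?_).le_of_ae_hasDerivAt_nonneg hT ?_
    · rw [Set.uIcc_of_le hT] at ht
      exact contDiffAt_directionGap (h.lamSq_pos ht₀ hsep (ht₁₀.trans ht.1)) v e₂
    · filter_upwards [h.ae_flow] with t ht htT
      obtain ⟨w, hw, -, hQ, hflow⟩ := ht ((ht₀.trans ht₁₀).trans_lt htT.1)
      obtain ⟨h1, h2, h3, h4⟩ := ht₁ t htT.1.le
      refine ⟨_, hasDerivAt_directionGap_comp hw hM (h.lamSq_pos ht₀ hsep h4) v e₂, ?_⟩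
      set σ := lamScale lam (θ t) with hσdef
      set U := psi lam (-σ) (θ t) with hU
      have hθU : θ t = psi lam σ U := by rw [hU, psi_psi_neg]
      have hb := hflow (Real.exp (-(σ * lamMax lam)) • psi lam σ v)
        (fun p => gapWeight p (fun q => S q (θ t)) *
          (Real.exp (-(σ * lamMax lam)) * Real.exp σ * β p)) fun p g hg => by
        refine mul_le_mul_of_nonneg_left ?_ (gapWeight_pos _ _).le
        rw [hθU] at hg
        have h5 := h1 p _ ((h.quasi p).smul_psi_mem_clarkeSubdifferential hg)
        rw [inner_smul_right, ← inner_psi_left] at h5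
        rw [inner_smul_left]
        have h6 : Real.exp σ * β p ≤ inner ℝ (psi lam σ v) g := by
          have := mul_le_mul_of_nonneg_left h5 (Real.exp_pos σ).le
          rwa [← mul_assoc, ← Real.exp_add, add_neg_cancel, Real.exp_zero, one_mul] at this
        rw [mul_assoc]
        exact mul_le_mul_of_nonneg_left h6 (Real.exp_pos _).le
      have hsumβ : ∑ p, gapWeight p (fun q => S q (θ t)) *
          (Real.exp (-(σ * lamMax lam)) * Real.exp σ * β p) =
          Real.exp (-(σ * lamMax lam)) * Real.exp σ *
            ∑ p, gapWeight p (fun q => S q (θ t)) * β p := by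
        rw [Finset.mul_sum]
        exact Finset.sum_congr rfl fun p _ => by ring
      have hQU : inner ℝ (lamMul lam (θ t)) w =
          Real.exp σ * ∑ p, gapWeight p (fun q => S q (θ t)) * S p U := by
        rw [hQ, Finset.mul_sum]
        refine Finset.sum_congr rfl fun p _ => ?_
        have : S p (θ t) = Real.exp σ * S p U := by
          conv_lhs => rw [hθU]
          exact h.quasi p σ U
        rw [this]
        ring
      have hQpos : 0 < inner ℝ (lamMul lam (θ t)) w := by
        rw [hQ]
        exact h.weighted_gap_pos ht₀ hsep h4
      have h7 : Real.exp (-(σ * lamMax lam)) * (inner ℝ (lamMul lam (θ t)) w * e₁) ≤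
          inner ℝ (Real.exp (-(σ * lamMax lam)) • psi lam σ v) w := by
        refine le_trans ?_ (hsumβ ▸ hb)
        rw [mul_assoc]
        refine mul_le_mul_of_nonneg_left ?_ (Real.exp_pos _).le
        rw [hQU, mul_assoc]
        refine mul_le_mul_of_nonneg_left ?_ (Real.exp_pos _).le
        linarith
      have h8 : 0 ≤ inner ℝ (lamMul lam (θ t)) w * Real.exp (-(σ * lamMax lam)) *
          (∑ i, v i * ((lam i - lamMax lam) / lamMax lam) *
            (Real.exp (σ * (lam i - lamMax lam)) ^ 2 * U i) - e₂ + e₁) :=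
        mul_nonneg (mul_nonneg hQpos.le (Real.exp_pos _).le) (by linarith)
      linarith
  have hlim : Tendsto (fun t => directionGap lam v e₂ (θ t) /
      Real.exp (lamScale lam (θ t) * lamMax lam)) atTop
      (𝓝 (∑ i, v i * topProj lam ubar i - e₂)) := by
    simp only [directionGap_div]
    exact (tendsto_sum_exp_mul hσ hu fun i => v i).sub_const e₂
  have hρ : Tendsto (fun t => Real.exp (lamScale lam (θ t) * lamMax lam)) atTop atTop :=
    Real.tendsto_exp_atTop.comp (hσ.atTop_mul_const hM)
  -- The test function is bounded below by its value at `t₁`; division by ‖θ‖_Λ → ∞ gives e₂ ≤ ⟨v,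
  -- topProj ubar⟩, against the choice of `e₂`.
  have hge := le_of_tendsto_of_tendsto
    (tendsto_const_nhds.div_atTop hρ : Tendsto (fun t => directionGap lam v e₂ (θ t₁) /
      Real.exp (lamScale lam (θ t) * lamMax lam)) atTop (𝓝 0)) hlim
    ((eventually_ge_atTop t₁).mono fun T hT =>
      div_le_div_of_nonneg_right (hmono T hT) (Real.exp_pos _).le)
  have hinner : inner ℝ v (topProj lam ubar) = ∑ i, v i * topProj lam ubar i := by
    simp only [PiLp.inner_apply, RCLike.inner_apply, conj_trivial]
    exact Finset.sum_congr rfl fun i _ => mul_comm _ _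
  linarith

end GapFlow

/-! ### The objective's gradient and the reduction of the Clarke flow to `GapFlow` -/

theorem gradient_half_lamMaxSeminorm_sq (hlam : ∀ i, 0 ≤ lam i) (θ : Params m) :
    gradient (fun ϑ => 1 / 2 * lamMaxSeminorm lam ϑ ^ 2) θ = lamMax lam • topProj lam θ := by
  classical
  refine HasGradientAt.gradient ?_
  simp only [lamMaxSeminorm_sq hlam]
  rw [hasGradientAt_iff_hasFDerivAt]
  have h := (HasFDerivAt.fun_sum (u := Finset.univ) fun i _ =>
    ((((EuclideanSpace.proj (𝕜 := ℝ) i : Params m →L[ℝ] ℝ).hasFDerivAt (x := θ)).pow 2).const_mul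
      ((if lam i = lamMax lam then (1 : ℝ) else 0) ^ 2)).const_mul (lam i)).const_mul (1 / 2 : ℝ)
  refine h.congr_fderiv ?_
  ext w
  simp only [InnerProductSpace.toDual_apply_apply, PiLp.inner_apply, smul_apply, sum_apply,
    smul_eq_mul, PiLp.smul_apply, topProj_apply, RCLike.inner_apply, conj_trivial, Finset.mul_sum,
    PiLp.proj_apply]
  refine Finset.sum_congr rfl fun i _ => ?_
  split_ifs with hi
  · rw [hi]
    norm_num
    ring
  · simp

theorem ae_imp_of_ae_restrict_Ioi {P : ℝ → Prop} {a : ℝ}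
    (h : ∀ᵐ t ∂(volume.restrict (Set.Ioi a)), P t) : ∀ᵐ t, a < t → P t :=
  (ae_restrict_iff' measurableSet_Ioi).1 h

theorem locallyLipschitz_sub {X : Type*} [PseudoMetricSpace X] {F G : X → ℝ}
    (hF : LocallyLipschitz F) (hG : LocallyLipschitz G) : LocallyLipschitz fun u => F u - G u :=
  (by fun_prop : ContDiff ℝ 1 fun q : ℝ × ℝ => q.1 - q.2).locallyLipschitz.comp (hF.prodMk hG)

theorem gradient_sub_eq_sum {F G : Params m → ℝ} {u : Params m}
    (h : ∀ k, DifferentiableAt ℝ ((![F, G] : Fin 2 → Params m → ℝ) k) u) :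
    gradient (fun w => F w - G w) u =
      ∑ k, (![1, -1] : Fin 2 → ℝ) k • gradient ((![F, G] : Fin 2 → Params m → ℝ) k) u := by
  have h0 : DifferentiableAt ℝ F u := h 0
  have h1 : DifferentiableAt ℝ G u := h 1
  refine HasGradientAt.gradient ?_
  rw [hasGradientAt_iff_hasFDerivAt]
  refine (h0.hasFDerivAt.fun_sub h1.hasFDerivAt).congr_fderiv ?_
  ext w
  simp [gradient, Fin.sum_univ_two, sub_eq_add_neg]

theorem gapFlow_of_isGradientFlow {X : Type*} (hn : 1 ≤ n) (hC : 2 ≤ C)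
    {f : X → Params m → Fin C → ℝ} {x : Fin n → X} {y : Fin n → Fin C}
    (hlam_nonneg : ∀ i, 0 ≤ lam i) (hlam_ne : lam ≠ 0)
    (h_quasi : ∀ (u : X) (c : Fin C), QuasiHomogeneous lam (fun ϑ => f u ϑ c))
    (h_lip : ∀ (u : X) (c : Fin C), LocallyLipschitz (fun ϑ => f u ϑ c))
    (h_chain : ∀ (u : X) (c : Fin C), AdmitsChainRule (fun ϑ => f u ϑ c))
    {θ : ℝ → Params m} (h_flow : IsGradientFlow (crossEntropyLoss f x y) θ) :
    GapFlow lam (fun p => scoreGap f x y p.1 p.2) y θ := by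
  have hlip : ∀ p : Fin n × Fin C, LocallyLipschitz (scoreGap f x y p.1 p.2) := fun p =>
    locallyLipschitz_sub (h_lip _ _) (h_lip _ _)
  have hquasi : ∀ p : Fin n × Fin C, QuasiHomogeneous lam (scoreGap f x y p.1 p.2) := by
    intro p α u
    have h1 := h_quasi (x p.1) (y p.1) α u
    have h2 := h_quasi (x p.1) p.2 α u
    simp only at h1 h2
    simp only [scoreGap, h1, h2]
    ring
  have hLlip : LocallyLipschitz fun u => gapLoss fun p => scoreGap f x y p.1 p.2 u :=
    (contDiff_gapLoss (by linarith : 0 < C)).locallyLipschitz.comp (locallyLipschitz_pi hlip)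
  have hweight_neg : ∀ p : Fin n × Fin C,
      Continuous fun u => -gapWeight p fun q => scoreGap f x y q.1 q.2 u := fun p =>
    ((continuous_gapWeight p).comp (continuous_pi fun q => (hlip q).continuous)).neg
  refine ⟨hn, hC, hlam_nonneg, hlam_ne, hquasi, hlip, fun j u => sub_self _, h_flow.1, ?_⟩
  have hchain : ∀ᵐ t, ∀ p : Fin n × Fin C, 0 < t →
      ∀ g ∈ clarkeSubdifferential (fun ϑ => f (x p.1) ϑ p.2) (θ t),
        HasDerivAt (fun r => f (x p.1) (θ r) p.2) (inner ℝ g (deriv θ t)) t :=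
    ae_all_iff.2 fun p => ae_imp_of_ae_restrict_Ioi (h_chain (x p.1) p.2 θ h_flow.1)
  filter_upwards [hchain, ae_imp_of_ae_restrict_Ioi h_flow.2] with t hct hft ht
  obtain ⟨v, hv, hmem⟩ := hft ht
  rw [show crossEntropyLoss f x y = fun u => gapLoss fun p => scoreGap f x y p.1 p.2 u from
    funext fun u => crossEntropyLoss_eq_gapLoss f x y u] at hmem
  -- Uniqueness of derivatives makes all subgradients of a score agree on `v`; this property then
  -- passes to the gaps and to the loss.
  have hd : ∀ p : Fin n × Fin C, ∃ d : ℝ, HasDerivAt (fun r => f (x p.1) (θ r) p.2) d t ∧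
      ∀ g ∈ clarkeSubdifferential (fun ϑ => f (x p.1) ϑ p.2) (θ t), inner ℝ v g = d := by
    intro p
    obtain ⟨g₀, hg₀⟩ := clarkeSubdifferential_nonempty (h_lip (x p.1) p.2) (θ t)
    have h0 := hct p ht g₀ hg₀
    refine ⟨_, h0, fun g hg => ?_⟩
    have h1 := (hct p ht g hg).unique h0
    rw [hv.deriv] at h1 ⊢
    rw [real_inner_comm, h1]
  choose d hd hdg using hd
  have hgap : ∀ p : Fin n × Fin C, ∀ g ∈ clarkeSubdifferential (scoreGap f x y p.1 p.2) (θ t),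
      inner ℝ v g = d (p.1, y p.1) - d p := by
    intro p g hg
    have := inner_eq_sum_of_mem_clarkeSubdifferential
      (F := ![fun ϑ => f (x p.1) ϑ (y p.1), fun ϑ => f (x p.1) ϑ p.2])
      (w := fun k _ => (![1, -1] : Fin 2 → ℝ) k) (d := ![d (p.1, y p.1), d p]) (v := v)
      (Fin.forall_fin_two.2 ⟨h_lip _ _, h_lip _ _⟩) (hlip p) (fun _ => continuous_const)
      (fun u hu => gradient_sub_eq_sum hu)
      (Fin.forall_fin_two.2 ⟨hdg (p.1, y p.1), hdg p⟩) hg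
    rw [this]
    simp [Fin.sum_univ_two, sub_eq_add_neg]
  have hgrad : ∀ u, (∀ p : Fin n × Fin C, DifferentiableAt ℝ (scoreGap f x y p.1 p.2) u) →
      gradient (fun u => gapLoss fun p => scoreGap f x y p.1 p.2 u) u =
        ∑ p, (-gapWeight p fun q => scoreGap f x y q.1 q.2 u) •
          gradient (scoreGap f x y p.1 p.2) u := fun u hu => gradient_gapLoss_comp hu
  -- Testing the subgradient -v against `v` gives the energy identity; testing it against Λθ gives
  -- the Euler identity.
  have hnorm := inner_eq_sum_of_mem_clarkeSubdifferential hlip hLlip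
    hweight_neg hgrad hgap hmem
  have heuler := inner_eq_sum_of_mem_clarkeSubdifferential hlip hLlip
    hweight_neg hgrad
    (fun p g hg => (hquasi p).inner_lamMul_eq (hlip p).continuous hg) hmem
  refine ⟨v, hv, ?_, ?_, fun V b hb => ?_⟩
  · rw [inner_neg_right, real_inner_self_eq_norm_sq] at hnorm
    rw [hnorm]
    exact hasDerivAt_gapLoss_comp fun p => (hd (p.1, y p.1)).sub (hd p)
  · rw [inner_neg_right] at heuler
    simp only [neg_mul, Finset.sum_neg_distrib] at heuler
    exact neg_injective heuler
  · have := sum_le_inner_of_mem_clarkeSubdifferential hlip hLlip hweight_neg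
      hgrad (v := -V) (b := b) (fun p g hg => by
        rw [inner_neg_left, neg_mul_neg]
        exact hb p g hg) hmem
    rwa [inner_neg_left, inner_neg_right, neg_neg] at this

end MaxMargin

/-! ### Rescaling the limit to a KKT point -/

theorem mainTheorem4 {X : Type*} {m n C : ℕ} (hn : 1 ≤ n) (hC : 2 ≤ C)
    (f : X → Params m → Fin C → ℝ) (x : Fin n → X) (y : Fin n → Fin C)
    (lam : Fin m → ℝ) (hlam_nonneg : ∀ i, 0 ≤ lam i) (hlam_ne : lam ≠ 0)
    (h_quasi : ∀ (u : X) (c : Fin C), QuasiHomogeneous lam (fun ϑ => f u ϑ c))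
    (h_lip : ∀ (u : X) (c : Fin C), LocallyLipschitz (fun ϑ => f u ϑ c))
    (h_chain : ∀ (u : X) (c : Fin C), AdmitsChainRule (fun ϑ => f u ϑ c))
    (θ : ℝ → Params m) (h_flow : IsGradientFlow (crossEntropyLoss f x y) θ)
    (h_sep : ∃ t₀ : ℝ, 0 ≤ t₀ ∧ crossEntropyLoss f x y (θ t₀) < (n : ℝ)⁻¹ * Real.log 2)
    (θlim : Params m)
    (h_conv : Filter.Tendsto (fun t => lamNormalize lam (θ t)) Filter.atTop (nhds θlim))
    (h_cond : ∃ κ : ℝ, 0 < κ ∧ ∀ ϑ : Params m, Separates f x y ϑ →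
      κ ≤ lamMaxSeminorm lam (lamNormalize lam ϑ)) :
    ∃ α : ℝ, IsMaxMarginKKTPoint lam f x y (psi lam α θlim) := by
  classical
  set S : Fin n × Fin C → Params m → ℝ := fun p => scoreGap f x y p.1 p.2 with hS
  have h : GapFlow lam S y θ :=
    gapFlow_of_isGradientFlow hn hC hlam_nonneg hlam_ne h_quasi h_lip h_chain h_flow
  obtain ⟨t₀, ht₀, hsep⟩ := h_sep
  rw [crossEntropyLoss_eq_gapLoss] at hsep
  obtain ⟨κ, hκ, hcond⟩ := h_cond
  have hcond' : ∀ t, t₀ ≤ t → κ ≤ lamMaxSeminorm lam (lamNormalize lam (θ t)) := fun t ht =>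
    hcond _ fun j c hc => h.gap_pos ht₀ hsep ht hc
  have hM := h.lamMax_pos
  obtain ⟨δ, hu⟩ := h.exists_tendsto_psi_neg_lamScale ht₀ hsep h_conv hκ hcond'
  have hσ : Filter.Tendsto (fun t => lamScale lam (θ t)) Filter.atTop Filter.atTop :=
    (Real.tendsto_log_atTop.comp
      (h.tendsto_lamSq_atTop ht₀ hsep h_conv hκ hcond')).atTop_div_const (by positivity)
  set ubar := psi lam δ θlim with hubar
  obtain ⟨k, hk, hkG⟩ := h.exists_mul_exp_lamScale_le ht₀ hsep
  have hmargin : ∀ p : Fin n × Fin C, p.2 ≠ y p.1 → k ≤ S p ubar := by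
    intro p hp
    refine ge_of_tendsto (((h.lip p).continuous.tendsto ubar).comp hu) ?_
    filter_upwards [Filter.eventually_ge_atTop t₀] with t ht
    have h1 := (hkG t ht).trans
      (smoothMargin_le_gap (s := fun p => S p (θ t)) (fun j => h.gap_self j (θ t)) hp)
    change k ≤ S p (psi lam (-lamScale lam (θ t)) (θ t))
    rw [h.quasi p, Real.exp_neg, inv_mul_eq_div, le_div_iff₀ (Real.exp_pos _)]
    exact h1
  obtain ⟨p₀, hp₀, hmin⟩ : ∃ p₀ : Fin n × Fin C, p₀.2 ≠ y p₀.1 ∧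
      ∀ p : Fin n × Fin C, p.2 ≠ y p.1 → S p₀ ubar ≤ S p ubar := by
    have : Nontrivial (Fin C) := Fin.nontrivial_iff_two_le.2 hC
    obtain ⟨c, hc⟩ := exists_ne (y ⟨0, hn⟩)
    obtain ⟨p₀, hp₀, hmin⟩ := Finset.exists_min_image
      (Finset.univ.filter fun p : Fin n × Fin C => p.2 ≠ y p.1) (fun p => S p ubar)
      ⟨(⟨0, hn⟩, c), by simpa using hc⟩
    exact ⟨p₀, (Finset.mem_filter.1 hp₀).2, fun p hp => hmin p (by simpa using hp)⟩
  set q := S p₀ ubar with hq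
  have hq0 : 0 < q := hk.trans_le (hmargin p₀ hp₀)
  obtain ⟨w, z, hw, hz, hw0, hwz⟩ := exists_sum_of_mem_convexHull_iUnion
    (fun p => convex_clarkeSubdifferential (S p) ubar)
    (fun p => clarkeSubdifferential_nonempty (h.lip p) ubar) _
    (h.smul_topProj_mem_convexHull ht₀ hsep hσ hu hp₀ hq0 hmin)
  -- This scale makes the smallest gap equal to 1, so active pairs become tight constraints.
  set α : ℝ := -Real.log q with hα
  have hαq : Real.exp α * q = 1 := by
    rw [hα, Real.exp_neg, Real.exp_log hq0, inv_mul_cancel₀ hq0.ne']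
  -- On top coordinates the gradient of the objective at ψ_α(ubar) scales by e^{α λ_max}, the
  -- transported subgradients by e^{α - α λ_max}. The exponent 2αλ_max makes up the difference, and
  -- the remaining e^α cancels q.
  set ω : ℝ := lamMax lam * Real.exp (2 * (α * lamMax lam)) with hω
  have hω0 : 0 ≤ ω := by positivity
  have hgapα : ∀ p, S p (psi lam α ubar) = Real.exp α * S p ubar := fun p => h.quasi p α ubar
  refine ⟨α + δ, ?_⟩
  rw [← psi_psi, ← hubar]
  refine ⟨fun p => ?_, fun p => w p.1 * ω, fun p => Real.exp α • psi lam (-α) (z p.1),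
    fun p => mul_nonneg (hw _) hω0, fun p => ?_, ?_, fun p => ?_⟩
  · change 1 ≤ S p.1 (psi lam α ubar)
    rw [hgapα, ← hαq]
    exact mul_le_mul_of_nonneg_left (hmin p.1 p.2) (Real.exp_pos _).le
  · have h1 : z p.1 ∈ clarkeSubdifferential (S p.1) (psi lam (-α) (psi lam α ubar)) := by
      rw [psi_neg_psi]
      exact hz p.1
    have h2 := (h.quasi p.1).smul_psi_mem_clarkeSubdifferential h1
    rwa [neg_neg] at h2
  · rw [gradient_half_lamMaxSeminorm_sq hlam_nonneg]
    have h1 : ∑ p : {p : Fin n × Fin C // p.2 ≠ y p.1},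
        (w p.1 * ω) • (Real.exp α • psi lam (-α) (z p.1)) =
        ∑ p, (w p * ω) • (Real.exp α • psi lam (-α) (z p)) := by
      rw [← Finset.sum_subtype (Finset.univ.filter fun p : Fin n × Fin C => p.2 ≠ y p.1) (by simp)
        fun p => (w p * ω) • (Real.exp α • psi lam (-α) (z p))]
      refine Finset.sum_subset (Finset.filter_subset _ _) fun p _ hp => ?_
      rw [hw0 p fun hcon => hp (by simpa using hcon.1), zero_mul, zero_smul]
    rw [h1]
    have h2 : ∑ p, (w p * ω) • (Real.exp α • psi lam (-α) (z p)) =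
        (ω * Real.exp α) • psiCLM lam (-α) (∑ p, w p • z p) := by
      rw [map_sum, Finset.smul_sum]
      refine Finset.sum_congr rfl fun p _ => ?_
      rw [map_smul, psiCLM_apply, smul_smul, smul_smul]
      congr 1
      ring
    rw [h2, hwz, map_smul, smul_smul, mul_assoc, hαq, mul_one, psiCLM_apply]
    ext i
    simp only [PiLp.smul_apply, topProj_apply, psi_apply, smul_eq_mul]
    split_ifs with hi
    · rw [hi, hω, mul_assoc, ← mul_assoc (Real.exp _) (Real.exp _), ← Real.exp_add]
      congr 3
      ring
    · simp
  · change w p.1 * ω * (S p.1 (psi lam α ubar) - 1) = 0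
    by_cases hact : S p.1 ubar = q
    · rw [hgapα, hact, hαq, sub_self, mul_zero]
    · rw [hw0 p.1 fun hcon => hact hcon.2, zero_mul, zero_mul]
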